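/- Let $k\ge 2$. For $M\ge 0$ the generalized $(331)$ theory has the $k\times k$ $K$-matrix $K_{aa}=M+2$, $K_{ab}=M$ ($a\ne b$). Its ground-state wave function for $n$ electrons of each of the $k$ colours, with coordinates $z^{(a)}_i\in\mathbb C$, is $$\Psi_{\tilde\Gamma}=\prod_{a<b}\prod_{i,j=1}^n\bigl(z^{(a)}_i-z^{(b)}_j\bigr)^{K_{ab}}\ \prod_{a=1}^k\prod_{1\le i<j\le n}\bigl(z^{(a)}_i-z^{(a)}_j\bigr)^{K_{aa}} .$$ Let $N=nk$, let $\mathcal S_N$ be the full symmetrization over $z_1,\dots,z_N$, normalized as a projector, let $\mathcal R$ be the relabelling $z^{(\ell)}_j\mapsto z_{(j-1)k+\ell}$, and put $$\widetilde\Psi_k(z_1,\dots,z_N)=\mathcal S_N\Bigl[\prod_{a=1}^k\prod_{1\le i<j\le n}\bigl(z^{(a)}_i-z^{(a)}_j\bigr)^2\Bigr]\Big|_{\mathcal R}.$$ The (reduced) Read–Rezayi wave function is $$\Psi_k=\mathcal S_N\Bigl[\prod_{0\le r<s<n}\chi_{r,s}\Bigr],\qquad \chi_{r,s}=\prod_{a=1}^k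 (z_{kr+a}-z_{ks+a})(z_{kr+a}-z_{ks+a+1}),$$ where in $\chi_{r,s}$ the index $ks+k+1$ is read as $ks+1$. Then the following hold. 1. For all $M\ge 0$ the $K$-matrix is invertible and the filling fraction is $\sum_{a,b}(K^{-1})_{ab}=\frac{k}{kM+2}$. Moreover $\Psi_{\tilde\Gamma}=J^M\prod_{a}\prod_{i<j}(z^{(a)}_i-z^{(a)}_j)^2$, where $J=\prod_{a<b}\prod_{i,j}(z^{(a)}_i-z^{(b)}_j)\prod_a\prod_{i<j}(z^{(a)}_i-z^{(a)}_j)$. 2. For all $n\ge 0$, $\widetilde\Psi_k\neq 0$, and $\widetilde\Psi_k=c\,\Psi_k$ with a constant $c\ne 0$. 3. For all $n\ge 0$ and pairwise distinct $z_1,\dots,z_N$, with a non-zero constant of proportionality depending only on $k$ and $n$, $$\widetilde\Psi_k(z_1,\dots,z_N)\ \propto\ \langle\psi_1(z_1)\cdots\psi_1(z_N)\rangle\prod_{i<j}(z_i-z_j)^{2/k},$$ the correlator of the first parafermion field of the $\mathbb Z_k$-parafermion conformal theory $\widehat{su(2)}_k/\widehat{u(1)}$. Here the right-hand side is understood, up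 to normalization of the fields, as $$\lim_{w\to x}\ \frac{\prod_{i=1}^N\prod_{r=1}^n(z_i-x_r)^2}{\prod_{r<s}(x_r-x_s)^{2k}}\ \bigl\langle E(z_1)\cdots E(z_N)F(w_1)\cdots F(w_N)\bigr\rangle_k$$ for any distinct points $x_1,\dots,x_n$ different from all $z_i$, where $w=(w_1,\dots,w_N)$ has pairwise distinct entries and $w_{(r-1)k+1},\dots,w_{rk}\to x_r$. The bracket $\langle\cdots\rangle_k$ is the vacuum correlator of the raising and lowering currents of $\widehat{su(2)}$ at level $k$, determined recursively by $\langle\ \rangle_k=1$ and the operator product expansion $J^X(z)J^Y(w)=\frac{k\,\mathrm{tr}(XY)}{(z-w)^2}+\frac{J^{[X,Y]}(w)}{z-w}+\text{regular}$, a correlator being the sum of its singular parts in its first point. 4. For every $n\ge 0$ (with $N=(n+1)k$) there is a constant $C\ne0$ such that, identically in $w,z_{k+1},\dots,z_N$, $$\widetilde\Psi_k(w,\dots,w,z_{k+1},\dots,z_N)=C\prod_{i=k+1}^N(w-z_i)^2\ \widetilde\Psi_k(z_{k+1},\dots,z_N),$$ and such that, for $z_k\notin\{z_{k+1},\dots,z_N\}$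 and as $u\to z_k$, $$\widetilde\Psi_k(u,\dots,u,z_k,z_{k+1},\dots,z_N)=C\Bigl(1+\tfrac{2(k-1)}{k}(u-z_k)\sum_{i>k}\tfrac1{z_k-z_i}\Bigr)\prod_{i>k}(z_k-z_i)^2\ \widetilde\Psi_k(z_{k+1},\dots,z_N)+O\bigl((u-z_k)^2\bigr),$$ where on the left $u$ occupies the first $k-1$ places, and $\widetilde\Psi_k$ on the right is the wave function of $N-k=nk$ electrons. -/

import Mathlib

open Topology Asymptotics

noncomputable section

namespace QHE

/-! ### The generalized (331) abelian theory -/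

/-- The `K`-matrix (Gram matrix) of the generalized (331) theory: `M + 2` on the diagonal,
`M` off the diagonal. -/
def kMatrix (k M : ℕ) : Matrix (Fin k) (Fin k) ℕ :=
  fun a b => if a = b then M + 2 else M

/-- The filling fraction `∑_{a,b} (K⁻¹)_{ab}` of an abelian theory with `K`-matrix `K`
and charge vector `(1, …, 1)`. -/
def filling {k : ℕ} (K : Matrix (Fin k) (Fin k) ℕ) : ℚ :=
  ∑ a, ∑ b, (K.map (Nat.cast : ℕ → ℚ))⁻¹ a b

/-- The ground-state wave function of the abelian theory with `K`-matrix `K`, with `n` electrons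
of each of the `k` colours. The variable `(i, a)` is the coordinate `z^{(a)}_i` of the `i`-th
electron of colour `a`; two electrons of colours `a`, `b` contribute their difference to the
power `K a b`. -/
def abelianWave (n : ℕ) {k : ℕ} (K : Matrix (Fin k) (Fin k) ℕ) :
    MvPolynomial (Fin n × Fin k) ℂ :=
  (∏ a, ∏ b ∈ Finset.Ioi a, ∏ i : Fin n, ∏ j : Fin n,
      (MvPolynomial.X (i, a) - MvPolynomial.X (j, b)) ^ K a b) *
    ∏ a, ∏ i : Fin n, ∏ j ∈ Finset.Ioi i,
      (MvPolynomial.X (i, a) - MvPolynomial.X (j, a)) ^ K a a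

/-- The `M = 0` factor `∏_a ∏_{i<j} (z^{(a)}_i - z^{(a)}_j)²`. -/
def colouredWave (n k : ℕ) : MvPolynomial (Fin n × Fin k) ℂ :=
  ∏ a : Fin k, ∏ i : Fin n, ∏ j ∈ Finset.Ioi i,
    (MvPolynomial.X (i, a) - MvPolynomial.X (j, a)) ^ 2

/-! ### Relabelling and symmetrization -/

/-- Full symmetrization over all the coordinates, normalized as a projector. -/
def symmetrize {N : ℕ} (p : MvPolynomial (Fin N) ℂ) : MvPolynomial (Fin N) ℂ :=
  ((N.factorial : ℂ)⁻¹) • ∑ e : Equiv.Perm (Fin N), MvPolynomial.rename e p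

/-- The relabelling of the doubly indexed coordinates into a single set of `n * k` coordinates.
In zero-based indices it is `(j, a) ↦ k * j + a`. -/
def relabel {n k : ℕ} (p : MvPolynomial (Fin n × Fin k) ℂ) : MvPolynomial (Fin (n * k)) ℂ :=
  MvPolynomial.rename finProdFinEquiv p

/-- The symmetrized generalized (331) wave function (with `M = 0`) of `N = n * k` electrons. -/
def symWave (n k : ℕ) : MvPolynomial (Fin (n * k)) ℂ :=
  symmetrize (relabel (colouredWave n k))

/-! ### The Read–Rezayi form of the parafermion ground state -/

/-- The factor `χ_{r,s}` linking the clusters `r` and `s`. The variable `(r, a)` is the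
`a`-th coordinate of the cluster `r`, and `finRotate k a` is the cyclic successor of `a`. -/
def chi {n k : ℕ} (r s : Fin n) : MvPolynomial (Fin n × Fin k) ℂ :=
  ∏ a : Fin k, (MvPolynomial.X (r, a) - MvPolynomial.X (s, a)) *
    (MvPolynomial.X (r, a) - MvPolynomial.X (s, finRotate k a))

/-- The (reduced, `M = 0`) Read–Rezayi wave function of `N = n * k` electrons. -/
def readRezayi (n k : ℕ) : MvPolynomial (Fin (n * k)) ℂ :=
  symmetrize (relabel (∏ r : Fin n, ∏ s ∈ Finset.Ioi r, chi r s))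

/-! ### Correlators of the parafermion conformal theory `su(2)_k / u(1)` -/

/-- Vacuum correlators `⟨J^{X₁}(z₁) ⋯ J^{X_m}(z_m)⟩` at distinct points of the currents of the
affine Lie algebra `su(2)` at level `k`, where a current is labelled by a traceless complex
2 × 2 matrix. They are computed from the operator product expansion
`J^X(z) J^Y(w) = k tr(XY) / (z-w)² + J^{[X,Y]}(w) / (z-w) + regular`: as a function of `z₁` the
correlator is the sum of its singular parts. -/
def currentCorr (k : ℕ) : List (Matrix (Fin 2) (Fin 2) ℂ × ℂ) → ℂ
  | [] => 1
  | (X, z) :: L =>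
      ∑ j : Fin L.length,
        ((k : ℂ) * (X * (L.get j).1).trace / (z - (L.get j).2) ^ 2 *
            currentCorr k (L.eraseIdx j) +
          1 / (z - (L.get j).2) *
            currentCorr k (L.set j (X * (L.get j).1 - (L.get j).1 * X, (L.get j).2)))
  termination_by L => L.length
  decreasing_by
    · have := j.isLt
      simp only [List.length_cons, List.length_eraseIdx]
      split <;> omega
    · simp

/-- `⟨E(z₁) ⋯ E(z_N) F(w₁) ⋯ F(w_N)⟩` at level `k`, for the raising and lowering currents. -/
def chargedCorr (k : ℕ) {N : ℕ} (z w : Fin N → ℂ) : ℂ :=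
  currentCorr k
    (List.ofFn (fun i => ((!![0, 1; 0, 0] : Matrix (Fin 2) (Fin 2) ℂ), z i)) ++
      List.ofFn (fun i => ((!![0, 0; 1, 0] : Matrix (Fin 2) (Fin 2) ℂ), w i)))

/-- `IsParafermionCorr k z v` says that, up to the normalization of the fields, the number `v` is
`⟨ψ₁(z₁) ⋯ ψ₁(z_N)⟩ ∏_{i<j} (z_i - z_j)^{2/k}`, where `N = n * k` and `ψ₁` is the first of the
parafermion fields.

Here `E = √k ψ₁ V` and `F = √k ψ₁† V†`, where `V`, `V†` are the `u(1)` vertex operators with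
`⟨∏ V(z_i) ∏ V†(w_j)⟩ = ∏_{i<j} (z_i - z_j)^{2/k} ∏_{i<j} (w_i - w_j)^{2/k} / ∏_{i,j} (z_i - w_j)^{2/k}`.
By the fusion rule `ψ₁†(w₁) ⋯ ψ₁†(w_k) ∼ ∏_{i<j} (w_i - w_j)^{-2/k}` times the identity, the fields
`ψ₁†` are removed by letting their positions merge in `n` clusters of `k` points, at arbitrary
distinct points `x₀, …, x_{n-1}`. In this limit the remaining `u(1)` factor is
`∏_{r<s} (x_r - x_s)^{2k} / ∏_{i,r} (z_i - x_r)²`, which is divided out. -/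
def IsParafermionCorr (k : ℕ) {n : ℕ} (z : Fin (n * k) → ℂ) (v : ℂ) : Prop :=
  ∀ x : Fin n → ℂ, Function.Injective x → (∀ i r, z i ≠ x r) →
    Filter.Tendsto
      (fun w : Fin (n * k) → ℂ =>
        (∏ i, ∏ r, (z i - x r) ^ 2) / (∏ r, ∏ s ∈ Finset.Ioi r, (x r - x s) ^ (2 * k)) *
          chargedCorr k z w)
      (𝓝[{w | Function.Injective w}] (fun i => x (finProdFinEquiv.symm i).1))
      (𝓝 v)

/-! ### Clusters -/

/-- The configuration whose first `k` coordinates are `c` and whose other coordinates are `y`. -/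
def joinCluster {n k : ℕ} (c : Fin k → ℂ) (y : Fin (n * k) → ℂ) : Fin ((n + 1) * k) → ℂ :=
  fun i => Fin.append c y (Fin.cast (by rw [Nat.succ_mul, Nat.add_comm]) i)

end QHE

end

/-!
The proof has two independent parts.

*Polynomials.* `symWave` and `readRezayi` are symmetric, have degree at most `2 (n - 1)` in each of
their `n k` variables, and satisfy the same cluster formula up to the constant: if `k` variables
coincide at `w`, the only surviving terms of the symmetrization have one variable of each colour
(respectively one whole cluster of the Read–Rezayi product) at `w`, and what is left is
`∏ (w - y i) ^ 2` times the wave function of the remaining variables (`sum_equiv_cluster`). In the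
Read–Rezayi product the factors of `χ_{r,s}` force the cluster number of the coinciding variables to
be non-increasing around the cycle of colours, hence constant (`eq_of_finRotate_le`). By induction,
a linear combination of the two wave functions vanishes on all `k`-clusters, and such a symmetric
polynomial of low degree is zero (`MvPolynomial.IsSymmetric.eq_zero_of_cluster`): if it vanishes
when `m + 1 ≤ k` variables coincide, then as a function of the common position of `m` variables it has
double zeros at the other ones, which are more zeros than its degree allows. The sub-leading term
near a cluster follows from the cluster formula, as the derivatives in the variables of a cluster
agree (`isBigO_joinCluster`).

*Current correlators.* The currents of `k` doublets of free fermions generate `su(2)` at level `k`.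
So the recursion defining `currentCorr` is solved by Wick's theorem, a sum of determinants
(`freeCorr`, `currentCorr_ofFn`): in the permutation expansion of the determinants the first point
is removed from its cycle by partial fractions. For the raising and lowering currents this becomes
a sum over colourings `c`, `c'` of the points `z`, `w` of the squared determinants of the matrices
with the entries `1 / (z i - w j)` if `c i = c' j`, and `0` otherwise (`chargedCorr_eq`). These
determinants are continuous where the points `w` merge in clusters `x r`. In the limit two points of
the same colour in a cluster give equal columns, so each cluster contains each colour once, and the
determinants are products of Cauchy determinants, one for each colour. Cauchy's formula and the sum
over the colourings give the symmetrization of `∏_a ∏_{i<j} (z^{(a)}_i - z^{(a)}_j)²`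
(`exists_sum_colour_merged`).
-/

namespace QHE

/-! ### Symmetric polynomials on clusters -/

open MvPolynomial in
/-- The chain rule for substituting univariate polynomials into a multivariate one. -/
theorem derivative_aeval_eq_sum_pderiv {σ R : Type*} [Fintype σ] [CommRing R]
    (φ : σ → Polynomial R) (p : MvPolynomial σ R) :
    Polynomial.derivative (aeval φ p) =
      ∑ j, aeval φ (pderiv j p) * Polynomial.derivative (φ j) := by
  classical
  induction p using MvPolynomial.induction_on with
  | C a => simp
  | add p q hp hq => simp [hp, hq, add_mul, Finset.sum_add_distrib]
  | mul_X p i hp =>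
    have h : ∀ j, aeval φ (pderiv j (p * X i)) * Polynomial.derivative (φ j) =
        aeval φ (pderiv j p) * Polynomial.derivative (φ j) * φ i +
          aeval φ p * (if j = i then Polynomial.derivative (φ j) else 0) := by
      intro j
      rw [Derivation.leibniz, smul_eq_mul, smul_eq_mul, map_add, map_mul, map_mul, aeval_X]
      rcases eq_or_ne j i with rfl | hj
      · rw [pderiv_X_self, map_one, if_pos rfl]
        ring
      · rw [pderiv_X_of_ne hj.symm, map_zero, if_neg hj]
        ring
    rw [Finset.sum_congr rfl fun j _ => h j, Finset.sum_add_distrib, ← Finset.sum_mul,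
      ← Finset.mul_sum, Finset.sum_ite_eq' Finset.univ i, if_pos (Finset.mem_univ i), map_mul,
      aeval_X, Polynomial.derivative_mul, hp]

/-- The substitution merging the variables in `S` into one variable and giving the other variables
the values `y`. -/
noncomputable def mergeVars {σ : Type*} [DecidableEq σ] (S : Finset σ) (y : σ → ℂ) :
    σ → Polynomial ℂ :=
  fun i => if i ∈ S then Polynomial.X else Polynomial.C (y i)

/-- The restriction of `p` to the line on which the variables in `S` coincide and the other
variables have the values `y`. -/
noncomputable def onCluster {σ : Type*} [DecidableEq σ] (S : Finset σ) (y : σ → ℂ)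
    (p : MvPolynomial σ ℂ) : Polynomial ℂ :=
  MvPolynomial.aeval (mergeVars S y) p

/-- The configuration whose points in `S` are at `w` and whose other points are as in `y`. -/
noncomputable def clusterAt {σ : Type*} [DecidableEq σ] (S : Finset σ) (y : σ → ℂ) (w : ℂ) :
    σ → ℂ :=
  fun i => if i ∈ S then w else y i

section Cluster
variable {σ : Type*} [DecidableEq σ] (S : Finset σ) (y : σ → ℂ) (p : MvPolynomial σ ℂ)

theorem eval_onCluster (w : ℂ) :
    (onCluster S y p).eval w = MvPolynomial.eval (clusterAt S y w) p := by
  rw [onCluster]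
  induction p using MvPolynomial.induction_on with
  | C a => simp
  | add p q hp hq => simp only [map_add, Polynomial.eval_add, hp, hq]
  | mul_X p i hp =>
    simp only [map_mul, hp, MvPolynomial.aeval_X, MvPolynomial.eval_X, Polynomial.eval_mul]
    congr 1
    simp only [mergeVars, clusterAt]
    split_ifs <;> simp

theorem derivative_onCluster [Fintype σ] :
    Polynomial.derivative (onCluster S y p) =
      ∑ j ∈ S, onCluster S y (MvPolynomial.pderiv j p) := by
  rw [onCluster, derivative_aeval_eq_sum_pderiv, ← Finset.sum_subset (Finset.subset_univ S)]
  · refine Finset.sum_congr rfl fun j hj => ?_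
    simp [mergeVars, hj, onCluster]
  · intro j _ hj
    simp [mergeVars, hj]

theorem natDegree_onCluster_le {d : ℕ} (hp : ∀ i, p.degreeOf i ≤ d) :
    (onCluster S y p).natDegree ≤ S.card * d := by
  rw [onCluster, MvPolynomial.aeval_def, MvPolynomial.eval₂_eq]
  refine Polynomial.natDegree_sum_le_of_forall_le _ _ fun m hm => ?_
  refine Polynomial.natDegree_C_mul_le _ _ |>.trans ?_
  refine (Polynomial.natDegree_prod_le _ _).trans ?_
  calc ∑ i ∈ m.support, (mergeVars S y i ^ m i).natDegree
      ≤ ∑ i ∈ m.support, if i ∈ S then d else 0 := by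
        refine Finset.sum_le_sum fun i _ => ?_
        refine Polynomial.natDegree_pow_le.trans ?_
        unfold mergeVars
        split_ifs
        · simpa using (MvPolynomial.monomial_le_degreeOf i hm).trans (hp i)
        · simp
    _ = ∑ i ∈ m.support.filter (· ∈ S), d := by rw [Finset.sum_filter]
    _ ≤ S.card * d := by
        rw [Finset.sum_const, smul_eq_mul]
        refine Nat.mul_le_mul_right _ (Finset.card_le_card fun i => ?_)
        simp
end Cluster

theorem _root_.MvPolynomial.IsSymmetric.eval_comp {σ : Type*} {p : MvPolynomial σ ℂ}
    (hp : p.IsSymmetric) (e : Equiv.Perm σ) (x : σ → ℂ) :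
    MvPolynomial.eval (x ∘ e) p = MvPolynomial.eval x p := by
  rw [← MvPolynomial.eval_rename, hp e]

section Symmetric
variable {σ : Type*} [DecidableEq σ] {p : MvPolynomial σ ℂ}

/-- The partial derivatives of a symmetric polynomial in two coinciding variables agree. -/
theorem _root_.MvPolynomial.IsSymmetric.eval_pderiv_eq (hp : p.IsSymmetric) {x : σ → ℂ} {i j : σ}
    (hx : x i = x j) :
    MvPolynomial.eval x (MvPolynomial.pderiv i p) =
      MvPolynomial.eval x (MvPolynomial.pderiv j p) := by
  have h := MvPolynomial.pderiv_rename (R := ℂ) (Equiv.swap i j).injective j p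
  rw [hp (Equiv.swap i j), Equiv.swap_apply_right] at h
  rw [h, MvPolynomial.eval_rename]
  congr 2
  funext a
  simp only [Function.comp, Equiv.swap_apply_def]
  split_ifs with h1 h2
  · rw [h1, hx]
  · rw [h2, hx]
  · rfl

/-- On a cluster of coinciding variables, each partial derivative of a symmetric polynomial in one
of these variables is the corresponding fraction of the derivative in their common position. -/
theorem _root_.MvPolynomial.IsSymmetric.card_mul_eval_pderiv [Fintype σ] (hp : p.IsSymmetric)
    (S : Finset σ) (y : σ → ℂ) (w : ℂ) {i : σ} (hi : i ∈ S) :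
    S.card * MvPolynomial.eval (clusterAt S y w) (MvPolynomial.pderiv i p) =
      (Polynomial.derivative (onCluster S y p)).eval w := by
  rw [derivative_onCluster, Polynomial.eval_finsetSum, ← nsmul_eq_mul, ← Finset.sum_const]
  refine Finset.sum_congr rfl fun j hj => ?_
  rw [eval_onCluster]
  exact hp.eval_pderiv_eq (by simp [clusterAt, hi, hj])

theorem clusterAt_insert (S : Finset σ) (y : σ → ℂ) (i : σ) :
    clusterAt (insert i S) y (y i) = clusterAt S y (y i) := by
  funext j
  simp only [clusterAt, Finset.mem_insert]
  by_cases h : j = i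
  · subst h; simp
  · simp [h]

/-- If a symmetric polynomial vanishes when the variables in `insert i S` coincide, its restriction
to coinciding variables in `S` has a double zero where these meet the variable `i`. -/
theorem _root_.MvPolynomial.IsSymmetric.sq_dvd_onCluster [Fintype σ] (hp : p.IsSymmetric)
    {S : Finset σ} {y : σ → ℂ} {i : σ} (h0 : onCluster (insert i S) y p = 0) :
    (Polynomial.X - Polynomial.C (y i)) ^ 2 ∣ onCluster S y p := by
  by_cases hz : onCluster S y p = 0
  · simp [hz]
  rw [← Polynomial.le_rootMultiplicity_iff hz]
  refine (Polynomial.one_lt_rootMultiplicity_iff_isRoot hz).2 ⟨?_, ?_⟩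
  · rw [Polynomial.IsRoot, eval_onCluster, ← clusterAt_insert, ← eval_onCluster, h0,
      Polynomial.eval_zero]
  · rw [Polynomial.IsRoot, derivative_onCluster, Polynomial.eval_finsetSum]
    refine Finset.sum_eq_zero fun j hj => ?_
    rw [eval_onCluster, ← clusterAt_insert]
    have := hp.card_mul_eval_pderiv (insert i S) y (y i) (Finset.mem_insert_of_mem hj)
    rw [h0, Polynomial.derivative_zero, Polynomial.eval_zero] at this
    refine (mul_eq_zero.1 this).resolve_left ?_
    exact_mod_cast (Finset.card_pos.2 ⟨i, Finset.mem_insert_self i S⟩).ne'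

/-- A symmetric polynomial which has degree at most `2 n` in each of its `(n + 1) * k` variables
and vanishes whenever `k` variables coincide is zero. If it vanishes when `m + 1 ≤ k` variables
coincide, then as a function of the common position of `m` variables it has degree at most
`2 m n` and double zeros at the `(n + 1) k - m` other variables, so it vanishes. -/
theorem _root_.MvPolynomial.IsSymmetric.eq_zero_of_cluster [Fintype σ] (hp : p.IsSymmetric)
    {n k : ℕ} (hcard : Fintype.card σ = (n + 1) * k) (hdeg : ∀ i, p.degreeOf i ≤ 2 * n)
    (hk : ∀ (S : Finset σ) (y : σ → ℂ) (w : ℂ), S.card = k →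
      MvPolynomial.eval (clusterAt S y w) p = 0) (hk1 : 1 ≤ k) : p = 0 := by
  have key : ∀ m, 1 ≤ m → m ≤ k → ∀ (S : Finset σ) (y : σ → ℂ), S.card = m →
      Function.Injective y → onCluster S y p = 0 := by
    intro m hm1 hmk
    induction hmk using Nat.decreasingInduction with
    | self =>
      intro S y hS _
      refine Polynomial.funext fun w => ?_
      rw [eval_onCluster, hk S y w hS, Polynomial.eval_zero]
    | of_succ m hmk ih =>
      intro S y hS hy
      have hdvd : ∏ i ∈ Sᶜ, (Polynomial.X - Polynomial.C (y i)) ^ 2 ∣ onCluster S y p := by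
        refine Finset.prod_dvd_of_coprime ?_ ?_
        · intro i _ j _ hij
          exact (Polynomial.pairwise_coprime_X_sub_C hy hij).pow
        · intro i hi
          refine hp.sq_dvd_onCluster (ih (by omega) _ y ?_ hy)
          rw [Finset.card_insert_of_notMem (Finset.mem_compl.1 hi), hS]
      refine Polynomial.eq_zero_of_dvd_of_natDegree_lt hdvd ?_
      refine (natDegree_onCluster_le S y p hdeg).trans_lt ?_
      rw [Polynomial.natDegree_prod_of_monic _ _ fun i _ => (Polynomial.monic_X_sub_C _).pow 2]
      simp only [Polynomial.natDegree_pow, Polynomial.natDegree_X_sub_C, Finset.sum_const,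
        Finset.card_compl, hcard, hS, smul_eq_mul, mul_one]
      have : m * n ≤ k * n := Nat.mul_le_mul_right _ (by omega)
      have h2 : (n + 1) * k = k * n + k := by ring
      rw [h2]
      have h3 : m * (2 * n) = 2 * (m * n) := by ring
      rw [h3]
      omega
  have hinj : ∀ y : σ → ℂ, Function.Injective y → MvPolynomial.eval y p = 0 := by
    intro y hy
    rcases isEmpty_or_nonempty σ with h | ⟨⟨i⟩⟩
    · have : Fintype.card σ = 0 := Fintype.card_eq_zero
      rw [hcard] at this
      have := Nat.mul_pos n.succ_pos hk1
      simp only [Nat.succ_eq_add_one] at this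
      omega
    · have h := key 1 le_rfl hk1 {i} y (by simp) hy
      have h2 := eval_onCluster {i} y p (y i)
      rw [h, Polynomial.eval_zero] at h2
      rw [h2]
      congr 2
      funext j
      simp only [clusterAt, Finset.mem_singleton]
      split_ifs with hj <;> simp [*]
  -- Off the diagonals `p` vanishes, so it vanishes after multiplication with all the differences.
  have hmul : p * ∏ i, ∏ j ∈ Finset.univ.erase i,
      (MvPolynomial.X i - MvPolynomial.X j : MvPolynomial σ ℂ) = 0 := by
    refine MvPolynomial.funext fun y => ?_
    rw [map_mul, map_zero]
    by_cases hy : Function.Injective y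
    · rw [hinj y hy, zero_mul]
    · obtain ⟨i, j, hij, hne⟩ := by simpa [Function.Injective] using hy
      refine mul_eq_zero_of_right _ ?_
      rw [map_prod]
      refine Finset.prod_eq_zero (Finset.mem_univ i) ?_
      rw [map_prod]
      exact Finset.prod_eq_zero (Finset.mem_erase.2 ⟨Ne.symm hne, Finset.mem_univ j⟩)
        (by simp [hij])
  refine (mul_eq_zero.1 hmul).resolve_right ?_
  refine Finset.prod_ne_zero_iff.2 fun i _ => Finset.prod_ne_zero_iff.2 fun j hj => ?_
  rw [sub_ne_zero]
  exact fun h => (Finset.mem_erase.1 hj).1 (MvPolynomial.X_injective h).symm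

end Symmetric

/-! ### Sums over the places of a cluster -/

/-- Splitting the product over the pairs `i < j` according to whether `p` is in the pair. -/
@[to_additive]
theorem prod_Ioi_succAbove {M : Type*} [CommMonoid M] {n : ℕ} (p : Fin (n + 1))
    (G : Fin (n + 1) → Fin (n + 1) → M) :
    ∏ i, ∏ j ∈ Finset.Ioi i, G i j =
      (∏ i : Fin n, if p < p.succAbove i then G p (p.succAbove i) else G (p.succAbove i) p) *
        ∏ i, ∏ j ∈ Finset.Ioi i, G (p.succAbove i) (p.succAbove j) := by
  have h : ∀ {m : ℕ} (H : Fin m → Fin m → M), ∏ i, ∏ j ∈ Finset.Ioi i, H i j =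
      ∏ i, ∏ j, if i < j then H i j else 1 := by
    intro m H
    refine Finset.prod_congr rfl fun i _ => ?_
    rw [← Finset.prod_filter]
    congr 1
    ext j
    simp
  rw [h, h, Fin.prod_univ_succAbove _ p, Fin.prod_univ_succAbove _ p]
  simp only [lt_irrefl, if_false, one_mul, Fin.prod_univ_succAbove _ p, Finset.prod_mul_distrib,
    Fin.succAbove_lt_succAbove_iff]
  rw [← mul_assoc, ← Finset.prod_mul_distrib]
  congr 1
  refine Finset.prod_congr rfl fun i _ => ?_
  rcases lt_or_gt_of_ne (Fin.succAbove_ne p i) with hlt | hlt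
  · rw [if_neg hlt.not_gt, if_pos hlt, if_neg hlt.not_gt, one_mul]
  · rw [if_pos hlt, if_neg hlt.not_gt, if_pos hlt, mul_one]

/-- The positions `(ρ a, a)`, one of each colour `a`, and the remaining ones, which are enumerated
in their order within each colour. -/
noncomputable def clusterEquiv {n k : ℕ} (ρ : Fin k → Fin (n + 1)) :
    Fin k ⊕ (Fin n × Fin k) ≃ Fin (n + 1) × Fin k :=
  Equiv.ofBijective
    (Sum.elim (fun a => (ρ a, a)) (fun i => ((ρ i.2).succAbove i.1, i.2))) <| by
    rw [Fintype.bijective_iff_injective_and_card]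
    refine ⟨?_, by simp [Nat.add_mul, Nat.add_comm]⟩
    rintro (a | ⟨i, a⟩) (b | ⟨j, b⟩) h <;>
      simp only [Sum.elim_inl, Sum.elim_inr, Prod.mk.injEq] at h
    · rw [h.2]
    · obtain ⟨h1, rfl⟩ := h
      exact absurd h1.symm (Fin.succAbove_ne _ _)
    · obtain ⟨h1, rfl⟩ := h
      exact absurd h1 (Fin.succAbove_ne _ _)
    · obtain ⟨h1, rfl⟩ := h
      rw [Fin.succAbove_right_injective h1]

@[simp] theorem clusterEquiv_inr {n k : ℕ} (ρ : Fin k → Fin (n + 1)) (i : Fin n × Fin k) :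
    clusterEquiv ρ (Sum.inr i) = ((ρ i.2).succAbove i.1, i.2) := rfl

/-- A permutation of `α ⊕ β` which maps `α` to itself is a pair of permutations. -/
theorem sum_perm_mapsTo_inl {α β : Type*} [Fintype α] [Fintype β] [DecidableEq α] [DecidableEq β]
    [DecidablePred fun g : Equiv.Perm (α ⊕ β) => ∀ a, (g (Sum.inl a)).isLeft]
    (f : Equiv.Perm (α ⊕ β) → ℂ) :
    ∑ g : Equiv.Perm (α ⊕ β), (if ∀ a, (g (Sum.inl a)).isLeft then f g else 0) =
      ∑ σ : Equiv.Perm α, ∑ τ : Equiv.Perm β, f (Equiv.Perm.sumCongr σ τ) := by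
  rw [← Finset.sum_filter, ← Fintype.sum_prod_type']
  symm
  refine Finset.sum_bij (fun p _ => Equiv.Perm.sumCongrHom α β p) ?_ ?_ ?_ ?_
  · intro p _
    simp
  · intro p _ q _ h
    exact Equiv.Perm.sumCongrHom_injective h
  · intro g hg
    rw [Finset.mem_filter] at hg
    have : g ∈ (Equiv.Perm.sumCongrHom α β).range := by
      refine Equiv.Perm.mem_sumCongrHom_range_of_perm_mapsTo_inl ?_
      rintro _ ⟨a, rfl⟩
      obtain ⟨b, hb⟩ := Sum.isLeft_iff.1 (hg.2 a)
      exact ⟨b, hb.symm⟩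
    obtain ⟨p, hp⟩ := this
    exact ⟨p, Finset.mem_univ _, hp⟩
  · intro p _
    rfl

/-- The sum over all the ways to place `k` coinciding points and `n * k` further points `y`, for a
function `F` that vanishes unless the coinciding points are at positions `(ρ a, a)` with `ρ ∈ R`,
and for these `ρ` splits off the factor `∏ i, (w - y i) ^ 2`. -/
theorem sum_equiv_cluster {n k : ℕ} (F : (Fin (n + 1) × Fin k → ℂ) → ℂ)
    (F' : (Fin n × Fin k → ℂ) → ℂ) (R : Finset (Fin k → Fin (n + 1)))
    (hzero : ∀ X i j a, i ≠ j → X (i, a) = X (j, a) → F X = 0)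
    (hR : ∀ X ρ w, (∀ a, X (ρ a, a) = w) → ρ ∉ R → F X = 0)
    (hF : ∀ X, ∀ ρ ∈ R, ∀ w, (∀ a, X (ρ a, a) = w) →
      F X = (∏ i, (w - X (clusterEquiv ρ (Sum.inr i))) ^ 2) *
        F' (fun i => X (clusterEquiv ρ (Sum.inr i))))
    (w : ℂ) (y : Fin n × Fin k → ℂ) :
    ∑ e : Fin (n + 1) × Fin k ≃ Fin k ⊕ (Fin n × Fin k), F (Sum.elim (fun _ => w) y ∘ e) =
      R.card * k.factorial * (∏ i, (w - y i) ^ 2) *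
        ∑ e : Equiv.Perm (Fin n × Fin k), F' (y ∘ e) := by
  classical
  set x : Fin k ⊕ (Fin n × Fin k) → ℂ := Sum.elim (fun _ => w) y with hx
  have hxl : ∀ s : Fin k ⊕ (Fin n × Fin k), s.isLeft → x s = w := by
    rintro (a | i) h
    · rfl
    · simp at h
  -- A nonzero term determines `ρ`: each colour contains exactly one of the coinciding points.
  have hA : ∀ e : Fin (n + 1) × Fin k ≃ Fin k ⊕ (Fin n × Fin k), F (x ∘ e) =
      ∑ ρ ∈ R, if ∀ a, (e (ρ a, a)).isLeft then F (x ∘ e) else 0 := by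
    intro e
    by_cases h0 : F (x ∘ e) = 0
    · simp [h0]
    have hsame : ∀ i j a, (e (i, a)).isLeft → (e (j, a)).isLeft → i = j := by
      intro i j a hi hj
      by_contra hij
      exact h0 (hzero _ i j a hij ((hxl _ hi).trans (hxl _ hj).symm))
    have hinj : Function.Injective fun b : Fin k => (e.symm (Sum.inl b)).2 := by
      intro b b' hb
      have h1 : (e.symm (Sum.inl b)).1 = (e.symm (Sum.inl b')).1 := by
        refine hsame _ _ (e.symm (Sum.inl b)).2 (by simp) ?_
        have hb' : (e.symm (Sum.inl b)).2 = (e.symm (Sum.inl b')).2 := hb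
        rw [hb']
        simp
      exact Sum.inl_injective (e.symm.injective (Prod.ext h1 hb))
    have hsurj := Finite.surjective_of_injective hinj
    choose β hβ using hsurj
    have hρ : ∀ a, (e ((e.symm (Sum.inl (β a))).1, a)).isLeft := by
      intro a
      have : ((e.symm (Sum.inl (β a))).1, a) = e.symm (Sum.inl (β a)) := Prod.ext rfl (hβ a).symm
      rw [this]
      simp
    set ρ : Fin k → Fin (n + 1) := fun a => (e.symm (Sum.inl (β a))).1 with hρdef
    have hmem : ρ ∈ R := by
      by_contra hn
      exact h0 (hR _ ρ w (fun a => hxl _ (hρ a)) hn)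
    rw [Finset.sum_eq_single_of_mem ρ hmem, if_pos hρ]
    intro ρ' _ hne
    rw [if_neg]
    intro h'
    exact hne (funext fun a => hsame _ _ a (h' a) (hρ a))
  -- For given `ρ` the points of the cluster and the remaining points are permuted independently.
  have hB : ∀ ρ ∈ R, ∑ e : Fin (n + 1) × Fin k ≃ Fin k ⊕ (Fin n × Fin k),
      (if ∀ a, (e (ρ a, a)).isLeft then F (x ∘ e) else 0) =
        k.factorial * (∏ i, (w - y i) ^ 2) * ∑ e : Equiv.Perm (Fin n × Fin k), F' (y ∘ e) := by
    intro ρ hρ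
    rw [← Equiv.sum_comp (Equiv.equivCongr (clusterEquiv ρ) (Equiv.refl (Fin k ⊕ (Fin n × Fin k))))]
    have h1 := sum_perm_mapsTo_inl (fun g : Equiv.Perm (Fin k ⊕ (Fin n × Fin k)) =>
      F (x ∘ (g ∘ (clusterEquiv ρ).symm)))
    have hsymm : ∀ a, (clusterEquiv ρ).symm (ρ a, a) = Sum.inl a := by
      intro a
      rw [Equiv.symm_apply_eq]
      rfl
    refine Eq.trans ?_ (h1.trans ?_)
    · refine Finset.sum_congr rfl fun g _ => ?_
      simp only [Equiv.equivCongr_apply_apply, Equiv.refl_apply, hsymm]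
      rfl
    · have h2 : ∀ (σ : Equiv.Perm (Fin k)) (τ : Equiv.Perm (Fin n × Fin k)),
          F (x ∘ (Equiv.Perm.sumCongr σ τ ∘ (clusterEquiv ρ).symm)) =
            (∏ i, (w - y i) ^ 2) * F' (y ∘ τ) := by
        intro σ τ
        rw [hF _ ρ hρ w]
        · have h3 : ∀ i, (x ∘ (Equiv.Perm.sumCongr σ τ ∘ (clusterEquiv ρ).symm))
              (clusterEquiv ρ (Sum.inr i)) = y (τ i) := by
            intro i
            simp only [Function.comp_apply, Equiv.symm_apply_apply, Equiv.Perm.sumCongr_apply,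
              Sum.map_inr, hx, Sum.elim_inr]
          simp only [h3]
          rw [Equiv.prod_comp τ (fun i => (w - y i) ^ 2)]
          rfl
        · intro a
          simp [hsymm, hx]
      simp only [h2]
      rw [Finset.sum_const, ← Finset.mul_sum, Finset.card_univ, Fintype.card_perm,
        Fintype.card_fin, nsmul_eq_mul]
      ring
  rw [Finset.sum_congr rfl fun e _ => hA e, Finset.sum_comm, Finset.sum_congr rfl hB,
    Finset.sum_const, nsmul_eq_mul]
  ring

/-! ### Clusters in symmetrized wave functions -/

theorem eval_symmetrize_relabel {n k : ℕ} (p : MvPolynomial (Fin n × Fin k) ℂ)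
    (x : Fin (n * k) → ℂ) :
    MvPolynomial.eval x (symmetrize (relabel p)) =
      ((n * k).factorial : ℂ)⁻¹ * ∑ e : Equiv.Perm (Fin (n * k)),
        MvPolynomial.eval (x ∘ e ∘ finProdFinEquiv) p := by
  simp only [symmetrize, relabel, MvPolynomial.smul_eval, map_sum, MvPolynomial.eval_rename]
  rfl

/-- The enumeration of the coordinates used by `joinCluster`. -/
def joinEquiv (n k : ℕ) : Fin k ⊕ (Fin n × Fin k) ≃ Fin ((n + 1) * k) :=
  ((Equiv.sumCongr (Equiv.refl _) finProdFinEquiv).trans finSumFinEquiv).trans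
    (finCongr (by rw [Nat.succ_mul, Nat.add_comm]))

theorem joinCluster_joinEquiv {n k : ℕ} (c : Fin k → ℂ) (y : Fin (n * k) → ℂ) :
    joinCluster c y ∘ joinEquiv n k = Sum.elim c (y ∘ finProdFinEquiv) := by
  funext s
  rcases s with a | i
  · simp [joinCluster, joinEquiv]
  · simp [joinCluster, joinEquiv]

/-- The cluster formula of `sum_equiv_cluster` for symmetrized polynomials. -/
theorem eval_symmetrize_cluster {n k : ℕ} (p : MvPolynomial (Fin (n + 1) × Fin k) ℂ)
    (p' : MvPolynomial (Fin n × Fin k) ℂ) (R : Finset (Fin k → Fin (n + 1)))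
    (hzero : ∀ X : Fin (n + 1) × Fin k → ℂ, ∀ i j a, i ≠ j → X (i, a) = X (j, a) →
      MvPolynomial.eval X p = 0)
    (hR : ∀ X : Fin (n + 1) × Fin k → ℂ, ∀ ρ w, (∀ a, X (ρ a, a) = w) → ρ ∉ R →
      MvPolynomial.eval X p = 0)
    (hF : ∀ X : Fin (n + 1) × Fin k → ℂ, ∀ ρ ∈ R, ∀ w, (∀ a, X (ρ a, a) = w) →
      MvPolynomial.eval X p = (∏ i, (w - X (clusterEquiv ρ (Sum.inr i))) ^ 2) *
        MvPolynomial.eval (fun i => X (clusterEquiv ρ (Sum.inr i))) p')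
    (w : ℂ) (y : Fin (n * k) → ℂ) :
    MvPolynomial.eval (joinCluster (fun _ => w) y) (symmetrize (relabel p)) =
      (((n + 1) * k).factorial : ℂ)⁻¹ * (R.card * k.factorial * (n * k).factorial) *
        (∏ i, (w - y i) ^ 2) * MvPolynomial.eval y (symmetrize (relabel p')) := by
  have h := sum_equiv_cluster (fun X => MvPolynomial.eval X p) (fun X => MvPolynomial.eval X p')
    R hzero hR hF w (y ∘ finProdFinEquiv)
  have h1 : ∑ e : Equiv.Perm (Fin ((n + 1) * k)),
      MvPolynomial.eval (joinCluster (fun _ => w) y ∘ e ∘ finProdFinEquiv) p =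
      ∑ e : Fin (n + 1) × Fin k ≃ Fin k ⊕ (Fin n × Fin k),
        MvPolynomial.eval (Sum.elim (fun _ => w) (y ∘ finProdFinEquiv) ∘ e) p := by
    rw [← joinCluster_joinEquiv]
    refine Fintype.sum_equiv
      (Equiv.equivCongr finProdFinEquiv.symm (joinEquiv n k).symm) _ _ fun e => ?_
    congr 2
    funext i
    simp
  have h2 : ∑ e : Equiv.Perm (Fin (n * k)), MvPolynomial.eval (y ∘ e ∘ finProdFinEquiv) p' =
      ∑ e : Equiv.Perm (Fin n × Fin k), MvPolynomial.eval ((y ∘ finProdFinEquiv) ∘ e) p' := by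
    refine Fintype.sum_equiv
      (Equiv.equivCongr finProdFinEquiv.symm finProdFinEquiv.symm) _ _ fun e => ?_
    congr 2
    funext i
    simp only [Function.comp_apply, Equiv.equivCongr_apply_apply, Equiv.symm_symm,
      Equiv.apply_symm_apply]
  have h3 : ∏ i, (w - (y ∘ finProdFinEquiv) i) ^ 2 = ∏ i, (w - y i) ^ 2 :=
    Equiv.prod_comp finProdFinEquiv fun i => (w - y i) ^ 2
  have h4 : ((n * k).factorial : ℂ) ≠ 0 := by exact_mod_cast Nat.factorial_ne_zero _
  rw [eval_symmetrize_relabel, eval_symmetrize_relabel, h1, h, h2, h3]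
  field_simp

theorem eval_colouredWave {n k : ℕ} (X : Fin n × Fin k → ℂ) :
    MvPolynomial.eval X (colouredWave n k) =
      ∏ a : Fin k, ∏ i : Fin n, ∏ j ∈ Finset.Ioi i, (X (i, a) - X (j, a)) ^ 2 := by
  simp [colouredWave]

theorem eval_chi {n k : ℕ} (X : Fin n × Fin k → ℂ) (r s : Fin n) :
    MvPolynomial.eval X (chi r s) =
      ∏ a : Fin k, (X (r, a) - X (s, a)) * (X (r, a) - X (s, finRotate k a)) := by
  simp [chi]

/-- The product of a family indexed by pairs `i < j` is zero if it has a zero at `(i, j)`, where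
the order of `i` and `j` does not matter. -/
theorem prod_Ioi_eq_zero {n : ℕ} {G : Fin n → Fin n → ℂ} {i j : Fin n} (hij : i ≠ j)
    (h : G i j = 0) (h' : G j i = 0) : ∏ i, ∏ j ∈ Finset.Ioi i, G i j = 0 := by
  rcases lt_or_gt_of_ne hij with hlt | hlt
  · exact Finset.prod_eq_zero (Finset.mem_univ i)
      (Finset.prod_eq_zero (Finset.mem_Ioi.2 hlt) h)
  · exact Finset.prod_eq_zero (Finset.mem_univ j)
      (Finset.prod_eq_zero (Finset.mem_Ioi.2 hlt) h')

theorem eval_symWave_cluster (n k : ℕ) (w : ℂ) (y : Fin (n * k) → ℂ) :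
    MvPolynomial.eval (joinCluster (fun _ => w) y) (symWave (n + 1) k) =
      (((n + 1) * k).factorial : ℂ)⁻¹ *
          (((n + 1) ^ k : ℕ) * k.factorial * (n * k).factorial) *
        (∏ i, (w - y i) ^ 2) * MvPolynomial.eval y (symWave n k) := by
  have h := eval_symmetrize_cluster (n := n) (k := k) (colouredWave (n + 1) k) (colouredWave n k)
    Finset.univ ?_ ?_ ?_ w y
  · rw [Finset.card_univ, Fintype.card_fun, Fintype.card_fin, Fintype.card_fin] at h
    exact h
  · intro X i j a hij hX
    rw [eval_colouredWave]
    refine Finset.prod_eq_zero (Finset.mem_univ a) (prod_Ioi_eq_zero hij ?_ ?_) <;> simp [hX]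
  · intro X ρ w _ h
    exact absurd (Finset.mem_univ _) h
  · intro X ρ _ w hw
    simp only [eval_colouredWave]
    simp only [fun a => prod_Ioi_succAbove (ρ a) fun i j => (X (i, a) - X (j, a)) ^ 2,
      Finset.prod_mul_distrib]
    congr 1
    rw [Fintype.prod_prod_type_right]
    refine Finset.prod_congr rfl fun a _ => Finset.prod_congr rfl fun i _ => ?_
    simp only [clusterEquiv_inr, hw]
    split_ifs
    · rfl
    · ring

/-- Going around a cycle, a function which never increases is constant. -/
theorem eq_of_finRotate_le {n k : ℕ} (ρ : Fin k → Fin n) (h : ∀ a, ρ (finRotate k a) ≤ ρ a)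
    (a b : Fin k) : ρ a = ρ b := by
  have hsum : ∑ a, (ρ (finRotate k a) : ℕ) = ∑ a, (ρ a : ℕ) :=
    Equiv.sum_comp (finRotate k) fun a => (ρ a : ℕ)
  have heq : ∀ a, ρ (finRotate k a) = ρ a := fun a =>
    Fin.ext ((Finset.sum_eq_sum_iff_of_le fun a _ => Fin.le_def.1 (h a)).1 hsum a
      (Finset.mem_univ a))
  rcases k with _ | k
  · exact a.elim0
  have h0 : ∀ a, ρ a = ρ 0 := by
    intro a
    induction a using Fin.induction with
    | zero => rfl
    | succ i ih =>
      rw [← ih, ← heq i.castSucc, finRotate_apply, Fin.coeSucc_eq_succ]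
  rw [h0 a, h0 b]

theorem eval_readRezayi_cluster (n k : ℕ) (hk : 1 ≤ k) (w : ℂ) (y : Fin (n * k) → ℂ) :
    MvPolynomial.eval (joinCluster (fun _ => w) y) (readRezayi (n + 1) k) =
      (((n + 1) * k).factorial : ℂ)⁻¹ *
          (((n + 1 : ℕ) : ℂ) * k.factorial * (n * k).factorial) *
        (∏ i, (w - y i) ^ 2) * MvPolynomial.eval y (readRezayi n k) := by
  have hfac : ∀ {m : ℕ} (X : Fin m × Fin k → ℂ),
      MvPolynomial.eval X (∏ r : Fin m, ∏ s ∈ Finset.Ioi r, chi (k := k) r s) =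
      ∏ r : Fin m, ∏ s ∈ Finset.Ioi r, ∏ a : Fin k,
        (X (r, a) - X (s, a)) * (X (r, a) - X (s, finRotate k a)) := by
    intro m X
    simp only [map_prod, eval_chi]
  have h := eval_symmetrize_cluster (n := n) (k := k)
    (∏ r : Fin (n + 1), ∏ s ∈ Finset.Ioi r, chi r s) (∏ r : Fin n, ∏ s ∈ Finset.Ioi r, chi r s)
    (Finset.univ.image fun r _ => r) ?_ ?_ ?_ w y
  · rw [Finset.card_image_of_injective, Finset.card_univ, Fintype.card_fin] at h
    · exact h
    · intro r s hrs
      exact congrFun hrs ⟨0, hk⟩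
  · intro X i j a hij hX
    rw [hfac]
    refine prod_Ioi_eq_zero hij ?_ ?_ <;>
      exact Finset.prod_eq_zero (Finset.mem_univ a) (by simp [hX])
  · intro X ρ w hw hρ
    rw [hfac]
    -- If `ρ` is not constant, it increases somewhere, and there a second factor of `χ` vanishes.
    have : ∃ a, ρ a < ρ (finRotate k a) := by
      by_contra hn
      push Not at hn
      refine hρ (Finset.mem_image.2 ⟨ρ ⟨0, hk⟩, Finset.mem_univ _, ?_⟩)
      exact funext fun a => eq_of_finRotate_le ρ hn _ _
    obtain ⟨a, ha⟩ := this
    refine Finset.prod_eq_zero (Finset.mem_univ (ρ a))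
      (Finset.prod_eq_zero (Finset.mem_Ioi.2 ha) (Finset.prod_eq_zero (Finset.mem_univ a) ?_))
    rw [hw, hw, sub_self, mul_zero]
  · intro X ρ hρ w hw
    obtain ⟨r, -, rfl⟩ := Finset.mem_image.1 hρ
    rw [hfac, hfac, prod_Ioi_succAbove r]
    congr 1
    rw [Fintype.prod_prod_type]
    refine Finset.prod_congr rfl fun i _ => ?_
    simp only [clusterEquiv_inr, hw, Finset.prod_mul_distrib, Finset.prod_pow]
    rw [Equiv.prod_comp (finRotate k) fun a => w - X (r.succAbove i, a)]
    split_ifs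
    · ring
    · rw [← sq, ← Finset.prod_pow, ← Finset.prod_pow]
      exact Finset.prod_congr rfl fun a _ => by ring

/-! ### Symmetry and degrees of the wave functions -/

theorem isSymmetric_symmetrize {N : ℕ} (p : MvPolynomial (Fin N) ℂ) :
    (symmetrize p).IsSymmetric := by
  intro σ
  simp only [symmetrize, map_smul, map_sum, MvPolynomial.rename_rename]
  congr 1
  exact Fintype.sum_equiv (Equiv.mulLeft σ) _ _ fun e => rfl

theorem degreeOf_symmetrize_relabel_le {n k d : ℕ} {p : MvPolynomial (Fin n × Fin k) ℂ}
    (hp : ∀ v, p.degreeOf v ≤ d) (i : Fin (n * k)) :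
    (symmetrize (relabel p)).degreeOf i ≤ d := by
  rw [symmetrize, MvPolynomial.smul_eq_C_mul]
  refine (MvPolynomial.degreeOf_C_mul_le _ _ _).trans
    ((MvPolynomial.degreeOf_sum_le _ _ _).trans ?_)
  refine Finset.sup_le fun e _ => ?_
  rw [relabel, MvPolynomial.rename_rename]
  obtain ⟨v, rfl⟩ := (finProdFinEquiv.trans e).surjective i
  exact (MvPolynomial.degreeOf_rename_of_injective (finProdFinEquiv.trans e).injective v).trans_le
    (hp v)

theorem degreeOf_X_sub_X_le {σ : Type*} [DecidableEq σ] (v i j : σ) :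
    (MvPolynomial.X i - MvPolynomial.X j : MvPolynomial σ ℂ).degreeOf v ≤
      (if i = v then 1 else 0) + if j = v then 1 else 0 := by
  refine (MvPolynomial.degreeOf_sub_le _ _ _).trans ?_
  rw [MvPolynomial.degreeOf_X, MvPolynomial.degreeOf_X]
  simp only [eq_comm (a := v)]
  split_ifs <;> simp

/-- A product over pairs of clusters has degree at most `2 n` in a variable of the cluster `r`, if
each of the `n` factors that involve `r` has degree at most `2`. -/
theorem degreeOf_prod_Ioi_le {σ : Type*} {n : ℕ} (v : σ) (r : Fin (n + 1))
    (G : Fin (n + 1) → Fin (n + 1) → MvPolynomial σ ℂ)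
    (hG : ∀ i j, (G i j).degreeOf v ≤ 2 * ((if i = r then 1 else 0) + if j = r then 1 else 0)) :
    (∏ i, ∏ j ∈ Finset.Ioi i, G i j).degreeOf v ≤ 2 * n := by
  refine (MvPolynomial.degreeOf_prod_le _ _ _).trans ?_
  calc ∑ i, (∏ j ∈ Finset.Ioi i, G i j).degreeOf v
      ≤ ∑ i, ∑ j ∈ Finset.Ioi i, 2 * ((if i = r then 1 else 0) + if j = r then 1 else 0) :=
        Finset.sum_le_sum fun i _ => (MvPolynomial.degreeOf_prod_le _ _ _).trans
          (Finset.sum_le_sum fun j _ => hG i j)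
    _ = 2 * n := by
        rw [sum_Ioi_succAbove r]
        simp [Fin.succAbove_ne, mul_comm]

theorem sum_ite_prod_eq {n k : ℕ} [DecidableEq (Fin n × Fin k)] (i r : Fin n)
    (e : Equiv.Perm (Fin k)) (c : Fin k) :
    ∑ a, (if (i, e a) = (r, c) then 1 else 0) = if i = r then 1 else 0 := by
  rw [Equiv.sum_comp e fun a => if (i, a) = (r, c) then 1 else 0]
  by_cases h : i = r <;> simp [h, Prod.ext_iff]

theorem degreeOf_chi_le {n k : ℕ} (i j r : Fin n) (c : Fin k) :
    (chi (k := k) i j).degreeOf (r, c) ≤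
      2 * ((if i = r then 1 else 0) + if j = r then 1 else 0) := by
  refine (MvPolynomial.degreeOf_prod_le _ _ _).trans ?_
  refine (Finset.sum_le_sum fun a _ => (MvPolynomial.degreeOf_mul_le _ _ _).trans
    (add_le_add (degreeOf_X_sub_X_le _ _ _) (degreeOf_X_sub_X_le _ _ _))).trans ?_
  have h1 : ∀ i, ∑ a, (if (i, a) = (r, c) then 1 else 0) = if i = r then 1 else 0 :=
    fun i => sum_ite_prod_eq i r (Equiv.refl (Fin k)) c
  simp only [Finset.sum_add_distrib, h1, sum_ite_prod_eq]
  omega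

theorem degreeOf_symWave_le {n k : ℕ} (i : Fin ((n + 1) * k)) :
    (symWave (n + 1) k).degreeOf i ≤ 2 * n := by
  refine degreeOf_symmetrize_relabel_le (fun v => ?_) i
  obtain ⟨r, c⟩ := v
  have h : colouredWave (n + 1) k = ∏ i : Fin (n + 1), ∏ j ∈ Finset.Ioi i, ∏ a : Fin k,
      (MvPolynomial.X (i, a) - MvPolynomial.X (j, a)) ^ 2 := by
    rw [colouredWave, Finset.prod_comm]
    exact Finset.prod_congr rfl fun i _ => Finset.prod_comm
  rw [h]
  refine degreeOf_prod_Ioi_le _ r _ fun i j => ?_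
  refine (MvPolynomial.degreeOf_prod_le _ _ _).trans ?_
  refine (Finset.sum_le_sum fun a _ => (MvPolynomial.degreeOf_pow_le _ _ _).trans
    (Nat.mul_le_mul_left 2 (degreeOf_X_sub_X_le _ _ _))).trans ?_
  have h1 : ∀ i, ∑ a, (if (i, a) = (r, c) then 1 else 0) = if i = r then 1 else 0 :=
    fun i => sum_ite_prod_eq i r (Equiv.refl (Fin k)) c
  rw [← Finset.mul_sum, Finset.sum_add_distrib, h1, h1]

theorem degreeOf_readRezayi_le {n k : ℕ} (i : Fin ((n + 1) * k)) :
    (readRezayi (n + 1) k).degreeOf i ≤ 2 * n :=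
  degreeOf_symmetrize_relabel_le
    (fun v => degreeOf_prod_Ioi_le _ v.1 _ fun i j => degreeOf_chi_le i j v.1 v.2) i

/-! ### The Read–Rezayi form -/

section Cluster
variable {n k : ℕ}

@[simp] theorem joinCluster_inl (c : Fin k → ℂ) (y : Fin (n * k) → ℂ) (a : Fin k) :
    joinCluster c y (joinEquiv n k (Sum.inl a)) = c a :=
  congrFun (joinCluster_joinEquiv c y) (Sum.inl a)

@[simp] theorem joinCluster_inr (c : Fin k → ℂ) (y : Fin (n * k) → ℂ) (i : Fin n × Fin k) :
    joinCluster c y (joinEquiv n k (Sum.inr i)) = y (finProdFinEquiv i) :=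
  congrFun (joinCluster_joinEquiv c y) (Sum.inr i)

/-- A symmetric polynomial that vanishes when its first `k` variables coincide vanishes when any
`k` variables coincide. -/
theorem eval_clusterAt_eq_zero {p : MvPolynomial (Fin ((n + 1) * k)) ℂ} (hp : p.IsSymmetric)
    (h0 : ∀ w y, MvPolynomial.eval (joinCluster (fun _ => w) y) p = 0)
    (S : Finset (Fin ((n + 1) * k))) (y : Fin ((n + 1) * k) → ℂ) (w : ℂ) (hS : S.card = k) :
    MvPolynomial.eval (clusterAt S y w) p = 0 := by
  classical
  have hcard : Fintype.card {i // ((joinEquiv n k).symm i).isLeft} = Fintype.card {i // i ∈ S} := by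
    rw [Fintype.card_coe, hS]
    have e : {s : Fin k ⊕ (Fin n × Fin k) // s.isLeft} ≃ {i // ((joinEquiv n k).symm i).isLeft} :=
      (joinEquiv n k).subtypeEquiv fun s => by simp
    rw [← Fintype.card_congr e]
    refine (Fintype.card_congr (Equiv.ofBijective
      (fun a : Fin k => (⟨Sum.inl a, rfl⟩ : {s : Fin k ⊕ (Fin n × Fin k) // s.isLeft}))
      ⟨fun a b h => ?_, ?_⟩)).symm.trans (Fintype.card_fin k)
    · exact Sum.inl_injective (congrArg Subtype.val h)
    · rintro ⟨s | s, hs⟩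
      · exact ⟨s, rfl⟩
      · simp at hs
  set e := (Fintype.equivOfCardEq hcard).extendSubtype with he
  have hmem : ∀ a, e (joinEquiv n k (Sum.inl a)) ∈ S := fun a =>
    Equiv.extendSubtype_mem _ _ (by simp)
  have hnot : ∀ i, e (joinEquiv n k (Sum.inr i)) ∉ S := fun i =>
    Equiv.extendSubtype_not_mem _ _ (by simp)
  rw [← hp.eval_comp e]
  convert h0 w (fun i => y (e (joinEquiv n k (Sum.inr (finProdFinEquiv.symm i))))) using 2
  congr 1
  funext i
  obtain ⟨s, rfl⟩ := (joinEquiv n k).surjective i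
  rcases s with a | i
  · simp [clusterAt, hmem]
  · simp only [Function.comp_apply, clusterAt, if_neg (hnot i), joinCluster_inr,
      Equiv.symm_apply_apply]

end Cluster

theorem symWave_zero (k : ℕ) : symWave 0 k = 1 := by
  simp [symWave, symmetrize, relabel, colouredWave]

theorem readRezayi_zero (k : ℕ) : readRezayi 0 k = 1 := by
  simp [readRezayi, symmetrize, relabel]

/-- The constant of the cluster formula for `symWave`. -/
theorem exists_eval_symWave_cluster (n k : ℕ) : ∃ c : ℂ, c ≠ 0 ∧
    ∀ (w : ℂ) (y : Fin (n * k) → ℂ),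
      MvPolynomial.eval (joinCluster (fun _ => w) y) (symWave (n + 1) k) =
        c * (∏ i, (w - y i) ^ 2) * MvPolynomial.eval y (symWave n k) := by
  refine ⟨_, ?_, eval_symWave_cluster n k⟩
  refine mul_ne_zero (inv_ne_zero (Nat.cast_ne_zero.2 (Nat.factorial_ne_zero _)))
    (mul_ne_zero (mul_ne_zero (Nat.cast_ne_zero.2 (by positivity)) ?_) ?_) <;>
  exact Nat.cast_ne_zero.2 (Nat.factorial_ne_zero _)

theorem symWave_ne_zero (n k : ℕ) : symWave n k ≠ 0 := by
  induction n with
  | zero => rw [symWave_zero]; exact one_ne_zero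
  | succ n ih =>
    obtain ⟨y, hy⟩ : ∃ y, MvPolynomial.eval y (symWave n k) ≠ 0 := by
      by_contra h
      push Not at h
      exact ih (MvPolynomial.funext fun y => by rw [h y, map_zero])
    obtain ⟨w, hw⟩ := (Set.finite_range y).exists_notMem
    obtain ⟨c, hc, h⟩ := exists_eval_symWave_cluster n k
    intro h0
    have h1 := h w y
    rw [h0, map_zero] at h1
    refine mul_ne_zero (mul_ne_zero hc (Finset.prod_ne_zero_iff.2 fun i _ => ?_)) hy h1.symm
    exact pow_ne_zero 2 (sub_ne_zero.2 fun h => hw ⟨i, h.symm⟩)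

/-- By the two cluster formulas and induction, a suitable linear combination of the two wave
functions vanishes when `k` coordinates coincide, so it is zero. -/
theorem exists_symWave_eq_smul_readRezayi (n : ℕ) {k : ℕ} (hk : 1 ≤ k) :
    ∃ c : ℂ, c ≠ 0 ∧ symWave n k = c • readRezayi n k := by
  induction n with
  | zero => exact ⟨1, one_ne_zero, by rw [symWave_zero, readRezayi_zero, one_smul]⟩
  | succ n ih =>
    obtain ⟨c, hc, h⟩ := ih
    obtain ⟨c₁, hc₁, h₁⟩ := exists_eval_symWave_cluster n k
    obtain ⟨c₂, hc₂, h₂⟩ : ∃ c₂ : ℂ, c₂ ≠ 0 ∧ ∀ (w : ℂ) (y : Fin (n * k) → ℂ),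
        MvPolynomial.eval (joinCluster (fun _ => w) y) (readRezayi (n + 1) k) =
          c₂ * (∏ i, (w - y i) ^ 2) * MvPolynomial.eval y (readRezayi n k) := by
      refine ⟨_, ?_, eval_readRezayi_cluster n k hk⟩
      refine mul_ne_zero (inv_ne_zero (Nat.cast_ne_zero.2 (Nat.factorial_ne_zero _)))
        (mul_ne_zero (mul_ne_zero (Nat.cast_ne_zero.2 (by positivity)) ?_) ?_) <;>
      exact Nat.cast_ne_zero.2 (Nat.factorial_ne_zero _)
    refine ⟨c₁ * c / c₂, div_ne_zero (mul_ne_zero hc₁ hc) hc₂, sub_eq_zero.1 ?_⟩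
    have hsymm : (symWave (n + 1) k - (c₁ * c / c₂) • readRezayi (n + 1) k).IsSymmetric :=
      (isSymmetric_symmetrize _).sub ((isSymmetric_symmetrize _).smul _)
    refine hsymm.eq_zero_of_cluster (n := n) (k := k) (by simp) (fun i => ?_)
      (eval_clusterAt_eq_zero hsymm fun w y => ?_) hk
    · refine (MvPolynomial.degreeOf_sub_le _ _ _).trans (max_le (degreeOf_symWave_le i) ?_)
      rw [MvPolynomial.smul_eq_C_mul]
      exact (MvPolynomial.degreeOf_C_mul_le _ _ _).trans (degreeOf_readRezayi_le i)
    · rw [map_sub, MvPolynomial.smul_eval, h₁, h₂, h, MvPolynomial.smul_eval]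
      field_simp
      ring

/-! ### Expansion near a cluster -/

theorem isBigO_sub_taylor (f : Polynomial ℂ) (z : ℂ) :
    (fun u => f.eval u - (f.eval z + (Polynomial.derivative f).eval z * (u - z)))
      =O[𝓝 z] fun u => (u - z) ^ 2 := by
  obtain ⟨q, hq⟩ := Polynomial.X_sub_C_dvd_sub_C_eval (a := z) (p := f)
  obtain ⟨r, hr⟩ := Polynomial.X_sub_C_dvd_sub_C_eval (a := z) (p := q)
  have hf : f = Polynomial.C (f.eval z) + (Polynomial.X - Polynomial.C z) * q := by
    rw [← hq]; ring
  have hd : (Polynomial.derivative f).eval z = q.eval z := by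
    conv_lhs => rw [hf]
    simp
  have hv : ∀ u, f.eval u - (f.eval z + (Polynomial.derivative f).eval z * (u - z)) =
      (u - z) ^ 2 * r.eval u := by
    intro u
    have h1 := congrArg (Polynomial.eval u) hq
    have h2 := congrArg (Polynomial.eval u) hr
    simp only [Polynomial.eval_sub, Polynomial.eval_C, Polynomial.eval_mul, Polynomial.eval_X]
      at h1 h2
    rw [hd]
    linear_combination h1 + (u - z) * h2
  simp only [hv]
  have hr1 : (fun u => r.eval u) =O[𝓝 z] fun _ => (1 : ℂ) :=
    r.continuous.continuousAt.isBigO_one ℂ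
  simpa using (Asymptotics.isBigO_refl (fun u : ℂ => (u - z) ^ 2) (𝓝 z)).mul hr1

theorem eval_derivative_prod_sq {ι : Type*} [Fintype ι] (z b : ℂ) (y : ι → ℂ)
    (hz : ∀ i, z ≠ y i) :
    (Polynomial.derivative (Polynomial.C b *
      ∏ i, (Polynomial.X - Polynomial.C (y i)) ^ 2)).eval z =
      b * ((∏ i, (z - y i) ^ 2) * ∑ i, 2 / (z - y i)) := by
  classical
  rw [Polynomial.derivative_C_mul, Polynomial.eval_C_mul, Polynomial.derivative_prod_finset,
    Polynomial.eval_finsetSum]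
  congr 1
  rw [Finset.mul_sum]
  refine Finset.sum_congr rfl fun i _ => ?_
  rw [← Finset.prod_erase_mul _ (fun i => (z - y i) ^ 2) (Finset.mem_univ i)]
  have : z - y i ≠ 0 := sub_ne_zero.2 (hz i)
  simp only [Polynomial.eval_mul, Polynomial.eval_prod, Polynomial.eval_pow, Polynomial.eval_sub,
    Polynomial.eval_X, Polynomial.eval_C, Polynomial.derivative_X_sub_C_sq]
  field_simp

/-- The derivatives in the coordinates of a cluster agree, so each is `1 / k` of the derivative in
the position of the cluster; moving `k - 1` of the coordinates gives the factor `(k - 1) / k`. -/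
theorem isBigO_joinCluster {n k : ℕ} (hk : 1 ≤ k) {p : MvPolynomial (Fin ((n + 1) * k)) ℂ}
    (hp : p.IsSymmetric) (z b : ℂ) (y : Fin (n * k) → ℂ) (hz : ∀ i, z ≠ y i)
    (hb : ∀ w, MvPolynomial.eval (joinCluster (fun _ => w) y) p = b * ∏ i, (w - y i) ^ 2) :
    (fun u : ℂ => MvPolynomial.eval
        (joinCluster (fun a : Fin k => if a.val + 1 = k then z else u) y) p -
      (b * ∏ i, (z - y i) ^ 2) * (1 + 2 * ((k : ℂ) - 1) / k * (u - z) * ∑ i, 1 / (z - y i)))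
      =O[𝓝 z] fun u : ℂ => (u - z) ^ 2 := by
  set x : Fin ((n + 1) * k) → ℂ := joinCluster (fun _ => z) y with hx
  set S : Finset (Fin ((n + 1) * k)) := Finset.univ.image (fun a => joinEquiv n k (Sum.inl a))
    with hS
  set l : Fin ((n + 1) * k) := joinEquiv n k (Sum.inl ⟨k - 1, by omega⟩) with hl
  have hlS : l ∈ S := Finset.mem_image_of_mem _ (Finset.mem_univ _)
  have hScard : S.card = k := by
    rw [hS, Finset.card_image_of_injective, Finset.card_univ, Fintype.card_fin]
    exact (joinEquiv n k).injective.comp Sum.inl_injective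
  have hSinl : ∀ a, joinEquiv n k (Sum.inl a) ∈ S := fun a =>
    Finset.mem_image_of_mem _ (Finset.mem_univ _)
  have hSinr : ∀ i, joinEquiv n k (Sum.inr i) ∉ S := by
    intro i h
    obtain ⟨a, -, ha⟩ := Finset.mem_image.1 h
    simpa using (joinEquiv n k).injective ha
  have hfull : ∀ w, clusterAt S x w = joinCluster (fun _ => w) y := by
    intro w
    funext i
    obtain ⟨s, rfl⟩ := (joinEquiv n k).surjective i
    rcases s with a | i
    · simp [clusterAt, hSinl]
    · simp [clusterAt, hSinr, hx]
  have hpart : ∀ u, clusterAt (S.erase l) x u =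
      joinCluster (fun a : Fin k => if a.val + 1 = k then z else u) y := by
    intro u
    funext i
    obtain ⟨s, rfl⟩ := (joinEquiv n k).surjective i
    rcases s with a | i
    · have : joinEquiv n k (Sum.inl a) = l ↔ a.val + 1 = k := by
        rw [hl, (joinEquiv n k).injective.eq_iff, Sum.inl_injective.eq_iff, Fin.ext_iff]
        change a.val = k - 1 ↔ _
        omega
      by_cases h : a.val + 1 = k
      · simp [clusterAt, this, h, hx]
      · simp [clusterAt, this, h, hSinl]
    · simp [clusterAt, hSinr, hx]
  have hA : onCluster S x p =
      Polynomial.C b * ∏ i, (Polynomial.X - Polynomial.C (y i)) ^ 2 := by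
    refine Polynomial.funext fun w => ?_
    rw [eval_onCluster, hfull, hb]
    simp [Polynomial.eval_prod]
  have hzz : clusterAt (S.erase l) x z = clusterAt S x z := by
    rw [hpart, hfull]
    congr 1
    funext a
    simp
  have hderiv : k * (Polynomial.derivative (onCluster (S.erase l) x p)).eval z =
      (k - 1) * (Polynomial.derivative (onCluster S x p)).eval z := by
    rw [derivative_onCluster, Polynomial.eval_finsetSum, Finset.mul_sum]
    have : ∀ j ∈ S.erase l, (k : ℂ) *
        (onCluster (S.erase l) x (MvPolynomial.pderiv j p)).eval z =
        (Polynomial.derivative (onCluster S x p)).eval z := by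
      intro j hj
      rw [eval_onCluster, hzz, ← hp.card_mul_eval_pderiv S x z (Finset.mem_of_mem_erase hj), hScard]
    rw [Finset.sum_congr rfl this, Finset.sum_const, Finset.card_erase_of_mem hlS, hScard,
      nsmul_eq_mul, Nat.cast_sub hk, Nat.cast_one]
  rw [hA, eval_derivative_prod_sq z b y hz] at hderiv
  have hk0 : (k : ℂ) ≠ 0 := by exact_mod_cast (by omega : k ≠ 0)
  have hT := isBigO_sub_taylor (onCluster (S.erase l) x p) z
  refine hT.congr_left fun u => ?_
  rw [eval_onCluster, eval_onCluster, hzz, hfull, hpart, hb]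
  have hd : (Polynomial.derivative (onCluster (S.erase l) x p)).eval z =
      (k - 1) * (b * ((∏ i, (z - y i) ^ 2) * ∑ i, 2 / (z - y i))) / k := by
    rw [← hderiv]
    field_simp
  rw [hd]
  have h2 : ∑ i, 2 / (z - y i) = 2 * ∑ i, 1 / (z - y i) := by
    rw [Finset.mul_sum]
    exact Finset.sum_congr rfl fun i _ => by ring
  rw [h2]
  ring

/-! ### Free fermion correlators -/

open Matrix in
/-- The vacuum correlator of the bilinears `:ψ† Y i ψ:(z i)` of free fermions whose flavours are
indexed by `κ`, by Wick's theorem: `s i` is the flavour that propagates into the point `z i`. As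
`1 / 0 = 0`, there are no propagators from a point to itself. -/
noncomputable def freeCorr {κ : Type*} [Fintype κ] {m : ℕ} (Y : Fin m → Matrix κ κ ℂ)
    (z : Fin m → ℂ) : ℂ :=
  (-1) ^ m * ∑ s : Fin m → κ, (of fun i j => Y i (s i) (s j) * (z i - z j)⁻¹).det

/-- The product over the cycles of `σ` of the traces of the matrices along the cycle. -/
noncomputable def cycleTrace {κ : Type*} [Fintype κ] {m : ℕ} (Y : Fin m → Matrix κ κ ℂ)
    (σ : Equiv.Perm (Fin m)) : ℂ :=
  ∑ s : Fin m → κ, ∏ i, Y i (s i) (s (σ i))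

/-- The product of the propagators along the cycles of `σ`. -/
noncomputable def cycleProp {m : ℕ} (z : Fin m → ℂ) (σ : Equiv.Perm (Fin m)) : ℂ :=
  ∏ i, (z i - z (σ i))⁻¹

theorem prod_update_apply {κ : Type*} {m : ℕ} (Y : Fin m → Matrix κ κ ℂ) (b : Fin m)
    (A : Matrix κ κ ℂ) (r c : Fin m → κ) :
    ∏ i, Function.update Y b A i (r i) (c i) =
      A (r b) (c b) * ∏ i ∈ Finset.univ.erase b, Y i (r i) (c i) := by
  rw [← Finset.mul_prod_erase _ _ (Finset.mem_univ b), Function.update_self]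
  congr 1
  refine Finset.prod_congr rfl fun i hi => ?_
  rw [Function.update_of_ne (Finset.ne_of_mem_erase hi)]

section
variable {κ : Type*} [Fintype κ] {m : ℕ}

theorem det_eq_sum_prod_apply {ι : Type*} [Fintype ι] [DecidableEq ι] (M : Matrix ι ι ℂ) :
    M.det = ∑ σ : Equiv.Perm ι, ((Equiv.Perm.sign σ : ℤ) : ℂ) * ∏ i, M i (σ i) := by
  rw [← Matrix.det_transpose, Matrix.det_apply']
  rfl

theorem freeCorr_eq_sum_perm (Y : Fin m → Matrix κ κ ℂ) (z : Fin m → ℂ) :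
    freeCorr Y z = (-1) ^ m * ∑ σ : Equiv.Perm (Fin m),
      ((Equiv.Perm.sign σ : ℤ) : ℂ) * (cycleProp z σ * cycleTrace Y σ) := by
  simp only [freeCorr, det_eq_sum_prod_apply, Matrix.of_apply, Finset.prod_mul_distrib]
  rw [Finset.sum_comm]
  congr 1
  refine Finset.sum_congr rfl fun σ _ => ?_
  rw [cycleTrace, Finset.mul_sum, Finset.mul_sum]
  exact Finset.sum_congr rfl fun s _ => by rw [cycleProp]; ring

theorem cycleTrace_update_sub (Y : Fin m → Matrix κ κ ℂ) (b : Fin m) (A B : Matrix κ κ ℂ)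
    (σ : Equiv.Perm (Fin m)) :
    cycleTrace (Function.update Y b (A - B)) σ =
      cycleTrace (Function.update Y b A) σ - cycleTrace (Function.update Y b B) σ := by
  simp only [cycleTrace, prod_update_apply _ b _ _ (fun i => _), ← Finset.sum_sub_distrib,
    Matrix.sub_apply, sub_mul]

/-- The cycle traces after inserting an additional point with matrix `A` in front of `b` into its
cycle. -/
noncomputable def insertTrace (A : Matrix κ κ ℂ) (Y : Fin m → Matrix κ κ ℂ) (σ : Equiv.Perm (Fin m))
    (b : Fin m) : ℂ :=
  ∑ s : Fin m → κ, ∑ t : κ, A t (s b) * ∏ i, Y i (s i) (Function.update s b t (σ i))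

theorem insertTrace_eq_sum_mul (A : Matrix κ κ ℂ) (Y : Fin m → Matrix κ κ ℂ)
    (σ : Equiv.Perm (Fin m)) (a : Fin m) :
    insertTrace A Y σ (σ a) = ∑ s : Fin m → κ, (Y a * A) (s a) (s (σ a)) *
      ∏ i ∈ Finset.univ.erase a, Y i (s i) (s (σ i)) := by
  refine Finset.sum_congr rfl fun s _ => ?_
  rw [Matrix.mul_apply, Finset.sum_mul]
  refine Finset.sum_congr rfl fun t _ => ?_
  rw [← Finset.mul_prod_erase _ _ (Finset.mem_univ a), Function.update_self]
  have : ∀ i ∈ Finset.univ.erase a, Y i (s i) (Function.update s (σ a) t (σ i)) =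
      Y i (s i) (s (σ i)) := by
    intro i hi
    rw [Function.update_of_ne (σ.injective.ne (Finset.ne_of_mem_erase hi))]
  rw [Finset.prod_congr rfl this]
  ring

theorem insertTrace_eq_cycleTrace_right (A : Matrix κ κ ℂ) (Y : Fin m → Matrix κ κ ℂ)
    (σ : Equiv.Perm (Fin m)) (a : Fin m) :
    insertTrace A Y σ (σ a) = cycleTrace (Function.update Y a (Y a * A)) σ := by
  rw [insertTrace_eq_sum_mul]
  exact Finset.sum_congr rfl fun s _ => (prod_update_apply Y a _ s fun i => s (σ i)).symm

/-- Exchanging the flavour at `b` with the one summed over. -/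
theorem sum_update_comm [DecidableEq κ] (b : Fin m) (f : (Fin m → κ) → κ → ℂ) :
    ∑ s : Fin m → κ, ∑ t, f (Function.update s b t) (s b) = ∑ s : Fin m → κ, ∑ t, f s t := by
  rw [← Fintype.sum_prod_type', ← Fintype.sum_prod_type']
  refine Finset.sum_bij' (fun p _ => (Function.update p.1 b p.2, p.1 b))
    (fun p _ => (Function.update p.1 b p.2, p.1 b)) ?_ ?_ ?_ ?_ ?_ <;> simp

theorem insertTrace_eq_cycleTrace_left (A : Matrix κ κ ℂ) (Y : Fin m → Matrix κ κ ℂ)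
    (σ : Equiv.Perm (Fin m)) (b : Fin m) :
    insertTrace A Y σ b = cycleTrace (Function.update Y b (A * Y b)) σ := by
  classical
  rw [insertTrace, ← sum_update_comm b]
  refine Finset.sum_congr rfl fun s _ => ?_
  rw [prod_update_apply Y b _ s fun i => s (σ i), Matrix.mul_apply, Finset.sum_mul]
  refine Finset.sum_congr rfl fun t _ => ?_
  rw [Function.update_self, Function.update_idem, Function.update_eq_self,
    ← Finset.mul_prod_erase _ _ (Finset.mem_univ b), Function.update_self]
  have : ∀ i ∈ Finset.univ.erase b, Y i (Function.update s b t i) (s (σ i)) =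
      Y i (s i) (s (σ i)) := by
    intro i hi
    rw [Function.update_of_ne (Finset.ne_of_mem_erase hi)]
  rw [Finset.prod_congr rfl this]
  ring

/-- The permutations of `Fin (m + 1)` without the fixed point `0` arise from those of `Fin m` by
inserting `0` in front of some `b`. -/
theorem cycleTrace_decomposeFin (Y : Fin (m + 1) → Matrix κ κ ℂ) (σ : Equiv.Perm (Fin m))
    (b : Fin m) :
    cycleTrace Y (Equiv.Perm.decomposeFin.symm (b.succ, σ)) =
      insertTrace (Y 0) (fun i => Y i.succ) σ b := by
  classical
  rw [cycleTrace, ← (Fin.consEquiv fun _ => κ).sum_comp, Fintype.sum_prod_type_right]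
  refine Finset.sum_congr rfl fun s _ => Finset.sum_congr rfl fun t _ => ?_
  rw [Fin.prod_univ_succ]
  simp only [Fin.consEquiv, Equiv.coe_fn_mk, Fin.cons_zero, Fin.cons_succ,
    Equiv.Perm.decomposeFin_symm_apply_zero, Equiv.Perm.decomposeFin_symm_apply_succ]
  congr 1
  refine Finset.prod_congr rfl fun i _ => ?_
  congr 1
  rcases eq_or_ne (σ i) b with h | h
  · rw [h, Equiv.swap_apply_right, Function.update_self, Fin.cons_zero]
  · rw [Equiv.swap_apply_of_ne_of_ne (Fin.succ_ne_zero _) ((Fin.succ_injective _).ne h),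
      Fin.cons_succ, Function.update_of_ne h]

/-- Partial fractions: inserting the point `z 0` in front of `b` into its cycle. If `b` is a fixed
point, the propagators of the two-cycle of `0` and `b` give a double pole. -/
theorem cycleProp_decomposeFin {z : Fin (m + 1) → ℂ} (hz : Function.Injective z)
    (σ : Equiv.Perm (Fin m)) (b : Fin m) :
    cycleProp z (Equiv.Perm.decomposeFin.symm (b.succ, σ)) =
      cycleProp (fun i => z i.succ) σ *
          (1 / (z 0 - z b.succ) - 1 / (z 0 - z (σ.symm b).succ)) -
        if σ b = b then ((z 0 - z b.succ) ^ 2)⁻¹ *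
          ∏ i ∈ Finset.univ.erase b, (z i.succ - z (σ i).succ)⁻¹ else 0 := by
  obtain ⟨a, rfl⟩ := σ.surjective b
  have h1 : ∀ i ∈ Finset.univ.erase a,
      (z i.succ - z (Equiv.swap 0 (σ a).succ (σ i).succ))⁻¹ = (z i.succ - z (σ i).succ)⁻¹ := by
    intro i hi
    rw [Equiv.swap_apply_of_ne_of_ne (Fin.succ_ne_zero _)
      ((Fin.succ_injective _).ne (σ.injective.ne (Finset.ne_of_mem_erase hi)))]
  rw [cycleProp, Fin.prod_univ_succ]
  simp only [Equiv.Perm.decomposeFin_symm_apply_zero, Equiv.Perm.decomposeFin_symm_apply_succ]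
  rw [← Finset.mul_prod_erase _ _ (Finset.mem_univ a), Finset.prod_congr rfl h1,
    Equiv.swap_apply_right, cycleProp, ← Finset.mul_prod_erase _ _ (Finset.mem_univ a),
    Equiv.symm_apply_apply]
  have h0 : ∀ i : Fin m, z 0 - z i.succ ≠ 0 := fun i =>
    sub_ne_zero.2 (hz.ne (Fin.succ_ne_zero i).symm)
  have h0' : ∀ i : Fin m, z i.succ - z 0 ≠ 0 := fun i =>
    sub_ne_zero.2 (hz.ne (Fin.succ_ne_zero i))
  by_cases h : σ a = a
  · rw [if_pos (by rw [h, h]), h, sub_self, inv_zero, zero_mul, zero_mul, zero_sub, ← mul_assoc,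
      ← neg_mul]
    congr 1
    have := h0 a
    have := h0' a
    field_simp
    ring
  · rw [if_neg (σ.injective.ne h), sub_zero]
    have h2 : z a.succ - z (σ a).succ ≠ 0 :=
      sub_ne_zero.2 (hz.ne ((Fin.succ_injective _).ne (Ne.symm h)))
    have := h0 a
    have := h0' a
    have := h0 (σ a)
    set P := ∏ i ∈ Finset.univ.erase a, (z i.succ - z (σ i).succ)⁻¹
    field_simp
    ring

/-- The contributions of the two-cycles of the first point and the point `b`. -/
theorem sum_perm_fixed {m : ℕ} (A : Matrix κ κ ℂ) (Y : Fin (m + 1) → Matrix κ κ ℂ)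
    (z : Fin (m + 1) → ℂ) (b : Fin (m + 1)) :
    ∑ σ : Equiv.Perm (Fin (m + 1)), ((Equiv.Perm.sign σ : ℤ) : ℂ) *
      ((if σ b = b then ∏ i ∈ Finset.univ.erase b, (z i - z (σ i))⁻¹ else 0) *
        insertTrace A Y σ b) =
      (A * Y b).trace * ∑ s : Fin m → κ, (Matrix.of fun i j => Y (b.succAbove i) (s i) (s j) *
        (z (b.succAbove i) - z (b.succAbove j))⁻¹).det := by
  classical
  have hminor : ∀ M : Matrix (Fin (m + 1)) (Fin (m + 1)) ℂ,
      ∑ σ : Equiv.Perm (Fin (m + 1)), ((Equiv.Perm.sign σ : ℤ) : ℂ) *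
        (if σ b = b then ∏ i ∈ Finset.univ.erase b, M i (σ i) else 0) =
      (M.submatrix b.succAbove b.succAbove).det := by
    intro M
    have h := Matrix.adjugate_fin_succ_eq_det_submatrix M b b
    rw [Even.neg_one_pow ⟨_, rfl⟩, one_mul, Matrix.adjugate_apply, det_eq_sum_prod_apply] at h
    rw [← h]
    refine Finset.sum_congr rfl fun σ _ => ?_
    congr 1
    rw [← Finset.mul_prod_erase _ _ (Finset.mem_univ b), Matrix.updateRow_self]
    have : ∀ i ∈ Finset.univ.erase b, (M.updateRow b (Pi.single b 1)) i (σ i) = M i (σ i) := by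
      intro i hi
      rw [Matrix.updateRow_ne (Finset.ne_of_mem_erase hi)]
    rw [Finset.prod_congr rfl this, Pi.single_apply]
    split_ifs <;> simp
  have hσ : ∀ σ : Equiv.Perm (Fin (m + 1)),
      (if σ b = b then ∏ i ∈ Finset.univ.erase b, (z i - z (σ i))⁻¹ else 0) *
        insertTrace A Y σ b = ∑ s : Fin (m + 1) → κ, (Y b * A) (s b) (s b) *
          if σ b = b then ∏ i ∈ Finset.univ.erase b, (Y i (s i) (s (σ i)) * (z i - z (σ i))⁻¹)
            else 0 := by
    intro σ
    by_cases h : σ b = b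
    · have h1 := insertTrace_eq_sum_mul A Y σ b
      rw [h] at h1
      simp only [if_pos h, h1, Finset.mul_sum, Finset.prod_mul_distrib]
      exact Finset.sum_congr rfl fun s _ => by ring
    · simp [h]
  simp only [hσ, Finset.mul_sum]
  rw [Finset.sum_comm]
  have hs : ∀ s : Fin (m + 1) → κ, ∑ σ : Equiv.Perm (Fin (m + 1)),
      ((Equiv.Perm.sign σ : ℤ) : ℂ) * ((Y b * A) (s b) (s b) *
        if σ b = b then ∏ i ∈ Finset.univ.erase b, (Y i (s i) (s (σ i)) * (z i - z (σ i))⁻¹)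
            else 0) = (Y b * A) (s b) (s b) *
        (Matrix.of fun i j => Y (b.succAbove i) (s (b.succAbove i)) (s (b.succAbove j)) *
          (z (b.succAbove i) - z (b.succAbove j))⁻¹).det := by
    intro s
    have h := hminor (Matrix.of fun i j => Y i (s i) (s j) * (z i - z j)⁻¹)
    refine Eq.trans ?_ (congrArg ((Y b * A) (s b) (s b) * ·) h)
    simp only [Finset.mul_sum, Matrix.of_apply]
    exact Finset.sum_congr rfl fun σ _ => by ring
  rw [Finset.sum_congr rfl fun s _ => hs s, ← (Fin.insertNthEquiv (fun _ => κ) b).sum_comp,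
    Fintype.sum_prod_type_right]
  refine Finset.sum_congr rfl fun s _ => ?_
  simp only [Fin.insertNthEquiv_apply, Fin.insertNth_apply_same, Fin.insertNth_apply_succAbove]
  rw [← Finset.sum_mul, Matrix.trace_mul_comm]
  rfl

/-- The correlator is the sum of its singular parts in the first point; the last sum contains the
double poles. -/
theorem freeCorr_succ {Y : Fin (m + 1) → Matrix κ κ ℂ} {z : Fin (m + 1) → ℂ}
    (hz : Function.Injective z) :
    freeCorr Y z =
      ∑ b : Fin m, 1 / (z 0 - z b.succ) * freeCorr
        (Function.update (fun i => Y i.succ) b (Y 0 * Y b.succ - Y b.succ * Y 0))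
        (fun i => z i.succ) -
      (-1) ^ m * ∑ b : Fin m, ((z 0 - z b.succ) ^ 2)⁻¹ * ∑ σ : Equiv.Perm (Fin m),
        ((Equiv.Perm.sign σ : ℤ) : ℂ) *
        ((if σ b = b then ∏ i ∈ Finset.univ.erase b, (z i.succ - z (σ i).succ)⁻¹ else 0) *
          insertTrace (Y 0) (fun i => Y i.succ) σ b) := by
  set y : Fin m → ℂ := fun i => z i.succ with hy
  set V : Fin m → Matrix κ κ ℂ := fun i => Y i.succ with hV
  have hset : ∀ σ : Equiv.Perm (Fin m),
      ∑ b, 1 / (z 0 - z b.succ) * cycleTrace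
        (Function.update V b (Y 0 * Y b.succ - Y b.succ * Y 0)) σ =
      ∑ b, (1 / (z 0 - z b.succ) - 1 / (z 0 - z (σ.symm b).succ)) * insertTrace (Y 0) V σ b := by
    intro σ
    simp only [cycleTrace_update_sub, mul_sub, sub_mul, Finset.sum_sub_distrib]
    congr 1
    · refine Finset.sum_congr rfl fun b _ => ?_
      rw [insertTrace_eq_cycleTrace_left]
    · rw [← Equiv.sum_comp σ fun b => 1 / (z 0 - z (σ.symm b).succ) * insertTrace (Y 0) V σ b]
      refine Finset.sum_congr rfl fun b _ => ?_
      rw [insertTrace_eq_cycleTrace_right, Equiv.symm_apply_apply]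
  have hL : freeCorr Y z = (-1) ^ m * ∑ σ : Equiv.Perm (Fin m), ((Equiv.Perm.sign σ : ℤ) : ℂ) *
      ∑ b : Fin m, cycleProp z (Equiv.Perm.decomposeFin.symm (b.succ, σ)) *
        insertTrace (Y 0) V σ b := by
    rw [freeCorr_eq_sum_perm, ← Equiv.Perm.decomposeFin.symm.sum_comp, Fintype.sum_prod_type_right,
      pow_succ, mul_assoc, neg_one_mul, ← Finset.sum_neg_distrib]
    congr 1
    refine Finset.sum_congr rfl fun σ _ => ?_
    rw [Fin.sum_univ_succ]
    have h0 : cycleProp z (Equiv.Perm.decomposeFin.symm (0, σ)) = 0 := by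
      refine Finset.prod_eq_zero (Finset.mem_univ 0) ?_
      rw [Equiv.Perm.decomposeFin_symm_apply_zero, sub_self, inv_zero]
    rw [h0, zero_mul, mul_zero, zero_add, Finset.mul_sum, ← Finset.sum_neg_distrib]
    refine Finset.sum_congr rfl fun b _ => ?_
    rw [cycleTrace_decomposeFin, Equiv.Perm.decomposeFin.symm_sign, if_neg (Fin.succ_ne_zero b)]
    push_cast
    ring
  have hR : ∑ b : Fin m, 1 / (z 0 - z b.succ) * freeCorr
        (Function.update V b (Y 0 * Y b.succ - Y b.succ * Y 0)) y =
      (-1) ^ m * ∑ σ : Equiv.Perm (Fin m), ((Equiv.Perm.sign σ : ℤ) : ℂ) * (cycleProp y σ *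
        ∑ b, (1 / (z 0 - z b.succ) - 1 / (z 0 - z (σ.symm b).succ)) *
          insertTrace (Y 0) V σ b) := by
    simp only [← hset, freeCorr_eq_sum_perm, Finset.mul_sum]
    rw [Finset.sum_comm]
    exact Finset.sum_congr rfl fun σ _ => Finset.sum_congr rfl fun b _ => by ring
  rw [hL, hR, ← mul_sub]
  congr 1
  simp only [Finset.mul_sum (s := (Finset.univ : Finset (Equiv.Perm (Fin m))))]
  rw [Finset.sum_comm (s := (Finset.univ : Finset (Fin m))), ← Finset.sum_sub_distrib]
  refine Finset.sum_congr rfl fun σ _ => ?_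
  rw [Finset.mul_sum, Finset.mul_sum, Finset.mul_sum, ← Finset.sum_sub_distrib]
  refine Finset.sum_congr rfl fun b _ => ?_
  rw [cycleProp_decomposeFin hz]
  split_ifs <;> ring

end

/-! ### Current correlators -/

open scoped Kronecker

theorem set_ofFn {α : Type*} {m : ℕ} (f : Fin m → α) (b : Fin m) (x : α) :
    (List.ofFn f).set b x = List.ofFn (Function.update f b x) := by
  refine List.ext_getElem (by simp) fun i h1 h2 => ?_
  rw [List.getElem_set, List.getElem_ofFn, List.getElem_ofFn, Function.update_apply]
  refine if_congr ?_ rfl rfl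
  rw [Fin.ext_iff, eq_comm]

theorem eraseIdx_ofFn {α : Type*} {m : ℕ} (f : Fin (m + 1) → α) (b : Fin (m + 1)) :
    (List.ofFn f).eraseIdx b = List.ofFn fun i => f (b.succAbove i) := by
  refine List.ext_getElem ?_ fun i h1 h2 => ?_
  · rw [List.length_eraseIdx_of_lt (by simpa using b.is_le), List.length_ofFn, List.length_ofFn]
    rfl
  · rw [List.length_ofFn] at h2
    have h3 : (List.ofFn fun i => f (b.succAbove i))[i]'(by simpa) = f (b.succAbove ⟨i, h2⟩) := by
      rw [List.getElem_ofFn]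
    rw [List.getElem_eraseIdx, h3]
    split_ifs with h
    · rw [List.getElem_ofFn, Fin.succAbove_of_castSucc_lt b ⟨i, h2⟩ h]
      rfl
    · rw [List.getElem_ofFn, Fin.succAbove_of_le_castSucc b ⟨i, h2⟩ (not_lt.1 h)]
      rfl

/-- The recursion of `currentCorr` for enumerated points. -/
theorem currentCorr_ofFn_succ (k : ℕ) {m : ℕ}
    (f : Fin (m + 1) → Matrix (Fin 2) (Fin 2) ℂ × ℂ) :
    currentCorr k (List.ofFn f) = ∑ b : Fin m,
      ((k : ℂ) * ((f 0).1 * (f b.succ).1).trace / ((f 0).2 - (f b.succ).2) ^ 2 *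
          currentCorr k ((List.ofFn fun i => f i.succ).eraseIdx b) +
        1 / ((f 0).2 - (f b.succ).2) * currentCorr k (List.ofFn
          (Function.update (fun i => f i.succ) b
            ((f 0).1 * (f b.succ).1 - (f b.succ).1 * (f 0).1, (f b.succ).2)))) := by
  rw [List.ofFn_succ, currentCorr]
  refine Fintype.sum_equiv (finCongr List.length_ofFn) _ _ fun j => ?_
  rw [← set_ofFn]
  have h : (List.ofFn fun i : Fin m => f i.succ).get j = f (finCongr List.length_ofFn j).succ := by
    rw [List.get_eq_getElem, List.getElem_ofFn]
    rfl
  rw [h]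
  rfl

/-- The current algebra of `k` doublets of free fermions has level `k`: the Wick expansion of the
bilinears satisfies the recursion of the current correlators. -/
theorem currentCorr_ofFn (k m : ℕ) (X : Fin m → Matrix (Fin 2) (Fin 2) ℂ) (z : Fin m → ℂ)
    (hz : Function.Injective z) :
    currentCorr k (List.ofFn fun i => (X i, z i)) =
      freeCorr (fun i => X i ⊗ₖ (1 : Matrix (Fin k) (Fin k) ℂ)) z := by
  induction m using Nat.strong_induction_on with
  | _ m IH =>
  rcases m with _ | m
  · simp [currentCorr, freeCorr]
  · have ih := fun X' => IH m m.lt_succ_self X' (fun i => z i.succ)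
      (hz.comp (Fin.succ_injective m))
    rw [currentCorr_ofFn_succ, freeCorr_succ hz, Finset.sum_add_distrib, add_comm,
      sub_eq_add_neg]
    congr 1
    · refine Finset.sum_congr rfl fun b _ => ?_
      congr 1
      have h1 : Function.update (fun i : Fin m => (X i.succ, z i.succ)) b
          (X 0 * X b.succ - X b.succ * X 0, z b.succ) = fun i => (Function.update
            (fun i : Fin m => X i.succ) b (X 0 * X b.succ - X b.succ * X 0) i, z i.succ) := by
        funext i
        rcases eq_or_ne i b with rfl | h
        · simp
        · simp [h]
      rw [h1, ih]
      congr 1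
      funext i
      rcases eq_or_ne i b with rfl | h
      · simp only [Function.update_self]
        rw [← Matrix.mul_kronecker_mul, ← Matrix.mul_kronecker_mul, Matrix.one_mul]
        ext ⟨p, c⟩ ⟨q, d⟩
        simp [Matrix.kroneckerMap_apply, sub_mul]
      · simp [h]
    · rw [Finset.mul_sum, ← Finset.sum_neg_distrib]
      refine Finset.sum_congr rfl fun b _ => ?_
      rcases m with _ | m
      · exact b.elim0
      have hinj : Function.Injective fun i => z (b.succAbove i).succ :=
        hz.comp ((Fin.succ_injective _).comp Fin.succAbove_right_injective)
      rw [sum_perm_fixed _ _ (fun i => z i.succ), eraseIdx_ofFn,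
        IH m (by omega) (fun i => X (b.succAbove i).succ) _ hinj, freeCorr,
        ← Matrix.mul_kronecker_mul, Matrix.one_mul, Matrix.trace_kronecker, Matrix.trace_one,
        Fintype.card_fin]
      ring

/-! ### Determinants -/

/-- Cauchy's determinant, squared. -/
theorem det_cauchy_sq : ∀ {n : ℕ} (x y : Fin n → ℂ), (∀ i j, x i ≠ y j) →
    (Matrix.of fun i j => (x i - y j)⁻¹).det ^ 2 =
      (∏ i, ∏ j ∈ Finset.Ioi i, (x i - x j) ^ 2) * (∏ i, ∏ j ∈ Finset.Ioi i, (y i - y j) ^ 2) /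
        ∏ i, ∏ j, (x i - y j) ^ 2
  | 0, x, y, _ => by simp
  | n + 1, x, y, h => by
    have hne : ∀ i j, x i - y j ≠ 0 := fun i j => sub_ne_zero.2 (h i j)
    have ih := det_cauchy_sq (fun i : Fin n => x i.succ) (fun j => y j.succ) fun i j => h _ _
    set A : Matrix (Fin n) (Fin n) ℂ := Matrix.of fun i j => (x i.succ - y j.succ)⁻¹ with hA
    -- Subtracting multiples of the row `0` clears the column `0`.
    set B : Matrix (Fin (n + 1)) (Fin (n + 1)) ℂ := Matrix.of fun i j => (x i - y j)⁻¹ -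
      (if i = 0 then 0 else (x 0 - y 0) / (x i - y 0)) * (x 0 - y j)⁻¹ with hB
    have h1 : (Matrix.of fun i j => (x i - y j)⁻¹).det = B.det := by
      refine Matrix.det_eq_of_forall_row_eq_smul_add_const
        (fun i => if i = 0 then 0 else (x 0 - y 0) / (x i - y 0)) 0 (if_pos rfl) fun i j => ?_
      simp [hB]
    have hB0 : ∀ i : Fin n, B i.succ 0 = 0 := by
      intro i
      have := hne i.succ 0
      have := hne 0 0
      simp only [hB, Matrix.of_apply, if_neg (Fin.succ_ne_zero i)]
      field_simp
      ring
    have h2 : B.det = (x 0 - y 0)⁻¹ * (Matrix.of fun i j =>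
        ((x i.succ - x 0) / (x i.succ - y 0)) * A i j *
          ((y 0 - y j.succ) / (x 0 - y j.succ))).det := by
      rw [Matrix.det_succ_column_zero, Fin.sum_univ_succ]
      have h3 : (B.submatrix (Fin.succAbove 0) Fin.succ) = Matrix.of fun i j =>
          ((x i.succ - x 0) / (x i.succ - y 0)) * A i j *
            ((y 0 - y j.succ) / (x 0 - y j.succ)) := by
        ext i j
        have := hne i.succ 0
        have := hne 0 j.succ
        have := hne i.succ j.succ
        simp only [hB, hA, Matrix.submatrix_apply, Matrix.of_apply, Fin.succAbove_zero,
          if_neg (Fin.succ_ne_zero i)]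
        field_simp
        ring
      rw [h3]
      simp [hB0]
      simp [hB]
    have h4 : (Matrix.of fun i j => ((x i.succ - x 0) / (x i.succ - y 0)) * A i j *
        ((y 0 - y j.succ) / (x 0 - y j.succ))).det =
        (∏ i : Fin n, (x i.succ - x 0) / (x i.succ - y 0)) * A.det *
          ∏ j : Fin n, (y 0 - y j.succ) / (x 0 - y j.succ) := by
      have h5 := Matrix.det_mul_column (fun i : Fin n => (x i.succ - x 0) / (x i.succ - y 0)) A
      have h6 := Matrix.det_mul_row (fun j : Fin n => (y 0 - y j.succ) / (x 0 - y j.succ))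
        (Matrix.of fun i j => (x i.succ - x 0) / (x i.succ - y 0) * A i j)
      rw [← h5, mul_comm, ← h6]
      congr 1
      ext i j
      simp only [Matrix.of_apply]
      ring
    rw [h1, h2, h4, mul_pow, mul_pow, mul_pow, ih]
    simp only [Fin.prod_univ_succ, Fin.prod_Ioi_zero, Fin.prod_Ioi_succ, Finset.prod_mul_distrib,
      Finset.prod_div_distrib, div_pow, Finset.prod_pow]
    have e1 : (∏ i : Fin n, (x i.succ - x 0)) ^ 2 = (∏ i : Fin n, (x 0 - x i.succ)) ^ 2 := by
      rw [← Finset.prod_pow, ← Finset.prod_pow]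
      exact Finset.prod_congr rfl fun i _ => by ring
    rw [e1]
    have := hne 0 0
    have p1 : ∏ i : Fin n, (x i.succ - y 0) ≠ 0 := Finset.prod_ne_zero_iff.2 fun i _ => hne _ _
    have p2 : ∏ i : Fin n, (x 0 - y i.succ) ≠ 0 := Finset.prod_ne_zero_iff.2 fun i _ => hne _ _
    have p3 : ∏ i : Fin n, ∏ j : Fin n, (x i.succ - y j.succ) ≠ 0 :=
      Finset.prod_ne_zero_iff.2 fun i _ => Finset.prod_ne_zero_iff.2 fun j _ => hne _ _
    field_simp

theorem det_fromBlocks_antidiagonal {ι : Type*} [Fintype ι] [DecidableEq ι]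
    (A : Matrix ι ι ℂ) : (Matrix.fromBlocks 0 A (-A.transpose) 0).det = A.det ^ 2 := by
  have h : Matrix.fromBlocks 0 A (-A.transpose) 0 =
      Matrix.fromBlocks A 0 0 1 * (Matrix.fromBlocks 1 1 0 1 * Matrix.fromBlocks 1 0 (-1) 1 *
        Matrix.fromBlocks 1 1 0 1) * Matrix.fromBlocks A.transpose 0 0 1 := by
    simp [Matrix.fromBlocks_multiply]
  rw [h]
  simp only [Matrix.det_mul, Matrix.det_fromBlocks_zero₂₁, Matrix.det_fromBlocks_zero₁₂,
    Matrix.det_one, Matrix.det_transpose]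
  ring

/-! ### Charged correlators -/

/-- The matrix of the propagators between the points `z` and `w` of the same colour. -/
noncomputable def colourMatrix {ι κ : Type*} [DecidableEq κ] (c c' : ι → κ) (z w : ι → ℂ) :
    Matrix ι ι ℂ :=
  Matrix.of fun i j => if c i = c' j then (z i - w j)⁻¹ else 0

open scoped Kronecker in
/-- Wick's theorem for the charged currents: the doublet index of the fermions is determined by
the currents, and the propagators connect each `z i` to two of the `w j` of the same colour. -/
theorem chargedCorr_eq (k : ℕ) {N : ℕ} {z w : Fin N → ℂ} (hz : Function.Injective z)
    (hw : Function.Injective w) (hzw : ∀ i j, z i ≠ w j) :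
    chargedCorr k z w =
      ∑ c : Fin N → Fin k, ∑ c' : Fin N → Fin k, (colourMatrix c c' z w).det ^ 2 := by
  set X : Fin (N + N) → Matrix (Fin 2) (Fin 2) ℂ :=
    Fin.append (fun _ => !![0, 1; 0, 0]) (fun _ => !![0, 0; 1, 0]) with hX
  set y : Fin (N + N) → ℂ := Fin.append z w with hy
  have hyl : ∀ i, y (Fin.castAdd N i) = z i := fun i => Fin.append_left _ _ _
  have hyr : ∀ i, y (Fin.natAdd N i) = w i := fun i => Fin.append_right _ _ _
  have hXl : ∀ i, X (Fin.castAdd N i) = !![0, 1; 0, 0] := fun i => Fin.append_left _ _ _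
  have hXr : ∀ i, X (Fin.natAdd N i) = !![0, 0; 1, 0] := fun i => Fin.append_right _ _ _
  have hyinj : Function.Injective y := by
    intro i j
    induction i using Fin.addCases with
    | left i =>
      induction j using Fin.addCases with
      | left j => rw [hyl, hyl]; exact fun h => by rw [hz h]
      | right j => rw [hyl, hyr]; exact fun h => absurd h (hzw i j)
    | right i =>
      induction j using Fin.addCases with
      | left j => rw [hyl, hyr]; exact fun h => absurd h.symm (hzw j i)
      | right j => rw [hyr, hyr]; exact fun h => by rw [hw h]
  have h1 : chargedCorr k z w = currentCorr k (List.ofFn fun i => (X i, y i)) := by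
    rw [chargedCorr, ← List.ofFn_fin_append]
    congr 2
    funext i
    induction i using Fin.addCases with
    | left i => rw [Fin.append_left, hyl, hXl]
    | right i => rw [Fin.append_right, hyr, hXr]
  rw [h1, currentCorr_ofFn k _ X y hyinj, freeCorr, Even.neg_one_pow ⟨N, rfl⟩, one_mul,
    ← Fintype.sum_prod_type']
  symm
  refine Fintype.sum_of_injective
    (fun p : (Fin N → Fin k) × (Fin N → Fin k) =>
      Fin.append (fun i => ((0 : Fin 2), p.1 i)) (fun i => ((1 : Fin 2), p.2 i))) ?_ _ _ ?_ ?_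
  · intro p q hpq
    refine Prod.ext (funext fun i => ?_) (funext fun i => ?_)
    · have := congrFun hpq (Fin.castAdd N i)
      simpa using this
    · have := congrFun hpq (Fin.natAdd N i)
      simpa only [Fin.append_right, Prod.mk.injEq, true_and] using this
  · intro s hs
    by_contra hdet
    refine hs ⟨(fun i => (s (Fin.castAdd N i)).2, fun i => (s (Fin.natAdd N i)).2), ?_⟩
    funext i
    by_contra hi
    -- Each current has a single nonzero row, so a wrong doublet index gives a zero row.
    refine hdet (Matrix.det_eq_zero_of_row_eq_zero i fun j => ?_)
    rw [Matrix.of_apply]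
    refine mul_eq_zero_of_left ?_ _
    rw [Matrix.kroneckerMap_apply]
    refine mul_eq_zero_of_left ?_ _
    induction i using Fin.addCases with
    | left i =>
      simp only [Fin.append_left] at hi
      have h2 : (s (Fin.castAdd N i)).1 = 1 := by
        have : (s (Fin.castAdd N i)).1 ≠ 0 := fun h => hi (Prod.ext h.symm rfl)
        omega
      rw [hXl, h2]
      generalize (s j).1 = q
      fin_cases q <;> rfl
    | right i =>
      simp only [Fin.append_right] at hi
      have h2 : (s (Fin.natAdd N i)).1 = 0 := by
        have : (s (Fin.natAdd N i)).1 ≠ 1 := fun h => hi (Prod.ext h.symm rfl)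
        omega
      rw [hXr, h2]
      generalize (s j).1 = q
      fin_cases q <;> rfl
  · rintro ⟨c, c'⟩
    rw [← Matrix.det_submatrix_equiv_self finSumFinEquiv, ← det_fromBlocks_antidiagonal]
    congr 1
    ext i j
    rcases i with i | i <;> rcases j with j | j
    · simp [hXl]
    · simp [-Fin.natAdd_eq_addNat, hXl, hyl, hyr, colourMatrix, Matrix.one_apply]
    · simp only [Matrix.fromBlocks_apply₂₁, Matrix.submatrix_apply, finSumFinEquiv_apply_left,
        finSumFinEquiv_apply_right, Matrix.of_apply, Fin.append_left, Fin.append_right, hXr, hyl,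
        hyr, colourMatrix, Matrix.kroneckerMap_apply, Matrix.one_apply, Matrix.neg_apply,
        Matrix.transpose_apply, eq_comm (a := c' i)]
      rw [← neg_sub (z j) (w i), inv_neg]
      split_ifs <;> simp
    · simp [-Fin.natAdd_eq_addNat, hXr]

/-! ### The limit of merging lowering currents -/

section
variable {n k : ℕ}

theorem det_colourMatrix_comp_right_sq {ι κ : Type*} [Fintype ι] [DecidableEq ι] [DecidableEq κ]
    (c c' : ι → κ) (z w : ι → ℂ) (τ : Equiv.Perm ι) (hw : ∀ i, w (τ i) = w i) :
    (colourMatrix c (c' ∘ τ) z w).det ^ 2 = (colourMatrix c c' z w).det ^ 2 := by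
  have h : colourMatrix c (c' ∘ τ) z w = (colourMatrix c c' z w).submatrix id τ := by
    ext i j
    simp [colourMatrix, hw]
  rw [h, Matrix.det_permute', mul_pow]
  rcases Int.units_eq_one_or (Equiv.Perm.sign τ) with h | h <;> simp [h]

theorem det_colourMatrix_comp_left_sq {ι κ : Type*} [Fintype ι] [DecidableEq ι] [DecidableEq κ]
    (c c' : ι → κ) (z w : ι → ℂ) (τ : Equiv.Perm ι) :
    (colourMatrix (c ∘ τ) c' z w).det ^ 2 = (colourMatrix c c' (z ∘ τ.symm) w).det ^ 2 := by
  have h : colourMatrix (c ∘ τ) c' z w =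
      (colourMatrix c c' (z ∘ τ.symm) w).submatrix τ id := by
    ext i j
    simp [colourMatrix]
  rw [h, Matrix.det_permute, mul_pow]
  rcases Int.units_eq_one_or (Equiv.Perm.sign τ) with h | h <;> simp [h]

/-- The sum over the colourings of the points in `n` clusters. Two points of the same colour in the
same cluster give equal columns; otherwise a permutation within the clusters makes the colouring the
standard one. -/
theorem exists_sum_colour_right : ∃ S : ℕ, S ≠ 0 ∧
    ∀ (c : Fin n × Fin k → Fin k) (z : Fin n × Fin k → ℂ) (x : Fin n → ℂ),
      ∑ c' : Fin n × Fin k → Fin k, (colourMatrix c c' z fun q => x q.1).det ^ 2 =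
        S * (colourMatrix c Prod.snd z fun q => x q.1).det ^ 2 := by
  classical
  set T : Finset (Fin n × Fin k → Fin k) :=
    Finset.univ.filter fun c' => ∀ r, Function.Injective fun a => c' (r, a) with hT
  refine ⟨T.card, Finset.card_ne_zero_of_mem (a := Prod.snd) ?_, fun c z x => ?_⟩
  · rw [hT, Finset.mem_filter]
    exact ⟨Finset.mem_univ _, fun r a b h => h⟩
  rw [← nsmul_eq_mul, ← Finset.sum_const, hT, Finset.sum_filter]
  refine Finset.sum_congr rfl fun c' _ => ?_
  split_ifs with h
  · have hb : ∀ r, Function.Bijective fun a => c' (r, a) := fun r =>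
      Finite.injective_iff_bijective.1 (h r)
    exact det_colourMatrix_comp_right_sq c Prod.snd z _
      (Equiv.prodShear (Equiv.refl (Fin n)) fun r => Equiv.ofBijective _ (hb r)) fun q => rfl
  · push Not at h
    obtain ⟨r, hr⟩ := h
    obtain ⟨a, b, hab, hne⟩ := by simpa [Function.Injective] using hr
    rw [Matrix.det_zero_of_column_eq (i := (r, a)) (j := (r, b)) (by simpa using hne)]
    · simp
    · intro p
      simp [colourMatrix, hab]

/-- The sum over the colourings of `n * k` points as a sum over permutations: a non-zero determinant
has a non-zero term, which provides a permutation that makes the colouring the standard one. -/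
theorem exists_sum_colour_left : ∃ S : ℕ, S ≠ 0 ∧
    ∀ (z w : Fin n × Fin k → ℂ),
      S * ∑ c : Fin n × Fin k → Fin k, (colourMatrix c Prod.snd z w).det ^ 2 =
        ∑ τ : Equiv.Perm (Fin n × Fin k), (colourMatrix Prod.snd Prod.snd (z ∘ τ) w).det ^ 2 := by
  classical
  set T : Finset (Equiv.Perm (Fin n × Fin k)) :=
    Finset.univ.filter fun τ => Prod.snd ∘ τ = (Prod.snd : Fin n × Fin k → Fin k) with hT
  refine ⟨T.card, Finset.card_ne_zero_of_mem (a := 1) ?_, fun z w => ?_⟩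
  · rw [hT, Finset.mem_filter]
    exact ⟨Finset.mem_univ _, rfl⟩
  rw [← Equiv.sum_comp (Equiv.inv (Equiv.Perm (Fin n × Fin k)))]
  have h1 : ∀ τ : Equiv.Perm (Fin n × Fin k),
      (colourMatrix Prod.snd Prod.snd (z ∘ (Equiv.inv (Equiv.Perm (Fin n × Fin k)) τ)) w).det ^ 2 =
        (colourMatrix (Prod.snd ∘ τ) Prod.snd z w).det ^ 2 := fun τ =>
    (det_colourMatrix_comp_left_sq Prod.snd Prod.snd z w τ).symm
  simp only [h1]
  rw [← Finset.sum_fiberwise (Finset.univ : Finset (Equiv.Perm (Fin n × Fin k)))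
    (fun τ => Prod.snd ∘ τ), Finset.mul_sum]
  refine Finset.sum_congr rfl fun c _ => ?_
  rw [Finset.sum_congr rfl (g := fun _ => (colourMatrix c Prod.snd z w).det ^ 2), Finset.sum_const,
    nsmul_eq_mul]
  · by_cases hdet : (colourMatrix c Prod.snd z w).det = 0
    · simp [hdet]
    obtain ⟨σ, hσ⟩ : ∃ σ : Equiv.Perm (Fin n × Fin k), Prod.snd ∘ σ = c := by
      by_contra hn
      push Not at hn
      refine hdet ?_
      rw [det_eq_sum_prod_apply]
      refine Finset.sum_eq_zero fun σ _ => mul_eq_zero_of_right _ ?_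
      obtain ⟨p, hp⟩ := Function.ne_iff.1 (hn σ)
      exact Finset.prod_eq_zero (Finset.mem_univ p) (if_neg fun h => hp h.symm)
    congr 2
    rw [hT]
    refine Finset.card_bij (fun τ _ => τ * σ) ?_ ?_ ?_
    · intro τ hτ
      rw [Finset.mem_filter] at hτ ⊢
      refine ⟨Finset.mem_univ _, ?_⟩
      rw [← hσ, Equiv.Perm.coe_mul, ← Function.comp_assoc, hτ.2]
    · intro τ _ τ' _ h
      exact mul_right_cancel h
    · intro τ hτ
      rw [Finset.mem_filter] at hτ
      refine ⟨τ * σ⁻¹, ?_, by simp⟩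
      rw [Finset.mem_filter]
      refine ⟨Finset.mem_univ _, funext fun p => ?_⟩
      have h2 := congrFun hτ.2 (σ⁻¹ p)
      have h3 := congrFun hσ (σ⁻¹ p)
      rw [← h3] at h2
      simpa using h2
  · intro τ hτ
    rw [← (Finset.mem_filter.1 hτ).2]

/-- With equal colourings, the determinant is a product of Cauchy determinants. -/
theorem det_colourMatrix_snd_sq (z : Fin n × Fin k → ℂ) (x : Fin n → ℂ)
    (h : ∀ p r, z p ≠ x r) :
    (colourMatrix Prod.snd Prod.snd z fun q => x q.1).det ^ 2 =
      MvPolynomial.eval z (colouredWave n k) *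
        (∏ r, ∏ s ∈ Finset.Ioi r, (x r - x s) ^ (2 * k)) / ∏ p, ∏ r, (z p - x r) ^ 2 := by
  have hB : colourMatrix Prod.snd Prod.snd z (fun q => x q.1) =
      Matrix.blockDiagonal fun a : Fin k => Matrix.of fun i r => (z (i, a) - x r)⁻¹ := by
    ext ⟨i, a⟩ ⟨r, b⟩
    rw [Matrix.blockDiagonal_apply]
    by_cases hab : a = b
    · subst hab
      simp [colourMatrix]
    · simp [colourMatrix, hab]
  have hC := fun a : Fin k => det_cauchy_sq (fun i => z (i, a)) x fun i r => h _ _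
  rw [hB, Matrix.det_blockDiagonal, ← Finset.prod_pow, Finset.prod_congr rfl fun a _ => hC a,
    Finset.prod_div_distrib, Finset.prod_mul_distrib, Finset.prod_const, eval_colouredWave,
    Fintype.prod_prod_type_right, Finset.card_univ, Fintype.card_fin]
  congr 2
  simp only [← Finset.prod_pow, ← pow_mul]

theorem tendsto_colourMatrix_det {N : ℕ} (c c' : Fin N → Fin k) (z w₀ : Fin N → ℂ)
    (h : ∀ i j, z i ≠ w₀ j) :
    Filter.Tendsto (fun w => (colourMatrix c c' z w).det) (𝓝 w₀)
      (𝓝 (colourMatrix c c' z w₀).det) := by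
  have hM : Filter.Tendsto (fun w => colourMatrix c c' z w) (𝓝 w₀)
      (𝓝 (colourMatrix c c' z w₀)) := by
    refine tendsto_pi_nhds.2 fun i => tendsto_pi_nhds.2 fun j => ?_
    simp only [colourMatrix, Matrix.of_apply]
    split_ifs
    · exact (tendsto_const_nhds.sub ((continuous_apply j).tendsto w₀)).inv₀
        (sub_ne_zero.2 (h i j))
    · exact tendsto_const_nhds
  exact ((continuous_id.matrix_det).tendsto _).comp hM

/-- The value of the Wick expansion where the points `w` have merged in `n` clusters. -/
theorem exists_sum_colour_merged (n k : ℕ) : ∃ C : ℂ, C ≠ 0 ∧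
    ∀ (z : Fin (n * k) → ℂ) (x : Fin n → ℂ), (∀ i r, z i ≠ x r) →
      ∑ c : Fin (n * k) → Fin k, ∑ c' : Fin (n * k) → Fin k,
        (colourMatrix c c' z fun i => x (finProdFinEquiv.symm i).1).det ^ 2 =
      C * MvPolynomial.eval z (symWave n k) *
        (∏ r, ∏ s ∈ Finset.Ioi r, (x r - x s) ^ (2 * k)) / ∏ i, ∏ r, (z i - x r) ^ 2 := by
  obtain ⟨S, hS, h1⟩ := exists_sum_colour_right (n := n) (k := k)
  obtain ⟨T, hT, h2⟩ := exists_sum_colour_left (n := n) (k := k)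
  have hf : ((n * k).factorial : ℂ) ≠ 0 := by exact_mod_cast Nat.factorial_ne_zero _
  have hS' : (S : ℂ) ≠ 0 := by exact_mod_cast hS
  have hT' : (T : ℂ) ≠ 0 := by exact_mod_cast hT
  refine ⟨S * (n * k).factorial / T, div_ne_zero (mul_ne_zero hS' hf) hT', fun z x hzx => ?_⟩
  have hre : ∑ c : Fin (n * k) → Fin k, ∑ c' : Fin (n * k) → Fin k,
      (colourMatrix c c' z fun i => x (finProdFinEquiv.symm i).1).det ^ 2 =
      ∑ c : Fin n × Fin k → Fin k, ∑ c' : Fin n × Fin k → Fin k,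
        (colourMatrix c c' (z ∘ finProdFinEquiv) fun q => x q.1).det ^ 2 := by
    refine Fintype.sum_equiv (Equiv.arrowCongr finProdFinEquiv.symm (Equiv.refl _)) _ _ fun c =>
      Fintype.sum_equiv (Equiv.arrowCongr finProdFinEquiv.symm (Equiv.refl _)) _ _ fun c' => ?_
    rw [← Matrix.det_submatrix_equiv_self finProdFinEquiv]
    congr 2
    ext p q
    simp only [colourMatrix, Matrix.submatrix_apply, Matrix.of_apply, Equiv.symm_apply_apply]
    rfl
  have hsym : MvPolynomial.eval z (symWave n k) = ((n * k).factorial : ℂ)⁻¹ *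
      ∑ τ : Equiv.Perm (Fin n × Fin k),
        MvPolynomial.eval ((z ∘ finProdFinEquiv) ∘ τ) (colouredWave n k) := by
    rw [symWave, eval_symmetrize_relabel]
    congr 1
    refine Fintype.sum_equiv
      (Equiv.equivCongr finProdFinEquiv.symm finProdFinEquiv.symm) _ _ fun e => ?_
    congr 2
    funext i
    simp only [Function.comp_apply, Equiv.equivCongr_apply_apply, Equiv.symm_symm,
      Equiv.apply_symm_apply]
  have hden : ∀ τ : Equiv.Perm (Fin n × Fin k),
      ∏ p, ∏ r, (((z ∘ finProdFinEquiv) ∘ τ) p - x r) ^ 2 = ∏ i, ∏ r, (z i - x r) ^ 2 := fun τ =>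
    (τ.trans finProdFinEquiv).prod_comp fun i => ∏ r, (z i - x r) ^ 2
  have h3 := h2 (z ∘ finProdFinEquiv) fun q => x q.1
  have h4 : ∀ τ : Equiv.Perm (Fin n × Fin k), (colourMatrix Prod.snd Prod.snd
      ((z ∘ finProdFinEquiv) ∘ τ) fun q => x q.1).det ^ 2 =
      MvPolynomial.eval ((z ∘ finProdFinEquiv) ∘ τ) (colouredWave n k) *
        (∏ r, ∏ s ∈ Finset.Ioi r, (x r - x s) ^ (2 * k)) / ∏ i, ∏ r, (z i - x r) ^ 2 := by
    intro τ
    rw [det_colourMatrix_snd_sq ((z ∘ finProdFinEquiv) ∘ τ) x fun p r => hzx _ _, hden]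
  simp only [h4, mul_div_assoc] at h3
  rw [← Finset.sum_mul] at h3
  rw [hre]
  simp only [h1]
  rw [← Finset.mul_sum, hsym, mul_div_assoc]
  set Q := (∏ r, ∏ s ∈ Finset.Ioi r, (x r - x s) ^ (2 * k)) / ∏ i, ∏ r, (z i - x r) ^ 2
  set W := ∑ τ : Equiv.Perm (Fin n × Fin k),
        MvPolynomial.eval ((z ∘ finProdFinEquiv) ∘ τ) (colouredWave n k)
  rw [eq_div_of_mul_eq hT' ((mul_comm _ _).trans h3)]
  field_simp

end

/-- Off the diagonals the limit defining the parafermion correlator is the value of the continuous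
right-hand side of `chargedCorr_eq` at the merged points. -/
theorem exists_isParafermionCorr (n k : ℕ) : ∃ c : ℂ, c ≠ 0 ∧
    ∀ z : Fin (n * k) → ℂ, Function.Injective z →
      IsParafermionCorr k z (c * MvPolynomial.eval z (symWave n k)) := by
  obtain ⟨C, hC, h⟩ := exists_sum_colour_merged n k
  refine ⟨C, hC, fun z hz x hx hzx => ?_⟩
  set w₀ : Fin (n * k) → ℂ := fun i => x (finProdFinEquiv.symm i).1 with hw₀
  have hzw₀ : ∀ i j, z i ≠ w₀ j := fun i j => hzx i _
  have hlim : Filter.Tendsto (fun w : Fin (n * k) → ℂ =>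
      ∑ c : Fin (n * k) → Fin k, ∑ c' : Fin (n * k) → Fin k, (colourMatrix c c' z w).det ^ 2)
      (𝓝[{w | Function.Injective w}] w₀)
      (𝓝 (∑ c : Fin (n * k) → Fin k, ∑ c' : Fin (n * k) → Fin k,
        (colourMatrix c c' z w₀).det ^ 2)) :=
    (tendsto_finsetSum _ fun c _ => tendsto_finsetSum _ fun c' _ =>
      (tendsto_colourMatrix_det c c' z w₀ hzw₀).pow 2).mono_left nhdsWithin_le_nhds
  have hev : ∀ᶠ w : Fin (n * k) → ℂ in 𝓝[{w | Function.Injective w}] w₀,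
      (∑ c : Fin (n * k) → Fin k, ∑ c' : Fin (n * k) → Fin k, (colourMatrix c c' z w).det ^ 2) =
        chargedCorr k z w := by
    have h1 : ∀ᶠ w : Fin (n * k) → ℂ in 𝓝 w₀, ∀ i j, z i ≠ w j := by
      refine Filter.eventually_all.2 fun i => Filter.eventually_all.2 fun j => ?_
      exact ((continuous_apply j).tendsto w₀).eventually_ne (hzw₀ i j).symm |>.mono
        fun w hw => hw.symm
    filter_upwards [self_mem_nhdsWithin, nhdsWithin_le_nhds h1] with w hw hzw
    exact (chargedCorr_eq k hz hw hzw).symm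
  have hlim2 := ((hlim.congr' hev).const_mul
    ((∏ i, ∏ r, (z i - x r) ^ 2) / (∏ r, ∏ s ∈ Finset.Ioi r, (x r - x s) ^ (2 * k))))
  rw [h z x hzx] at hlim2
  have hA : ∏ i, ∏ r, (z i - x r) ^ 2 ≠ 0 :=
    Finset.prod_ne_zero_iff.2 fun i _ => Finset.prod_ne_zero_iff.2 fun r _ =>
      pow_ne_zero _ (sub_ne_zero.2 (hzx i r))
  have hB : ∏ r, ∏ s ∈ Finset.Ioi r, (x r - x s) ^ (2 * k) ≠ 0 :=
    Finset.prod_ne_zero_iff.2 fun r _ => Finset.prod_ne_zero_iff.2 fun s hs =>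
      pow_ne_zero _ (sub_ne_zero.2 (hx.ne (Finset.mem_Ioi.1 hs).ne))
  convert hlim2 using 2
  field_simp

/-! ### The abelian theory -/

theorem kMatrix_map_mul (k M : ℕ) :
    (kMatrix k M).map (Nat.cast : ℕ → ℚ) *
      Matrix.of (fun a b : Fin k => (if a = b then 1 / 2 else 0) - (M : ℚ) / (2 * (k * M + 2))) =
      1 := by
  have h : (k * M + 2 : ℚ) ≠ 0 := by positivity
  ext a b
  have hK : ∀ c, ((kMatrix k M).map (Nat.cast : ℕ → ℚ)) a c = M + if a = c then 2 else 0 := by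
    intro c
    simp only [kMatrix, Matrix.map_apply]
    split_ifs <;> simp
  simp only [Matrix.mul_apply, hK, Matrix.of_apply, add_mul, mul_sub, ite_mul, zero_mul,
    Finset.sum_add_distrib, Finset.sum_sub_distrib, mul_ite, mul_zero, Finset.sum_ite_eq,
    Finset.sum_ite_eq', Finset.mem_univ, if_true, Finset.sum_const, Finset.card_univ,
    Fintype.card_fin, nsmul_eq_mul, Matrix.one_apply]
  split_ifs <;> field_simp <;> ring

theorem isUnit_det_kMatrix (k M : ℕ) :
    IsUnit ((kMatrix k M).map (Nat.cast : ℕ → ℚ)).det :=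
  Matrix.isUnit_det_of_right_inverse (kMatrix_map_mul k M)

theorem filling_kMatrix (k M : ℕ) : filling (kMatrix k M) = (k : ℚ) / (k * M + 2) := by
  have h : (k * M + 2 : ℚ) ≠ 0 := by positivity
  rw [filling, Matrix.inv_eq_right_inv (kMatrix_map_mul k M)]
  simp only [Matrix.of_apply, Finset.sum_sub_distrib, Finset.sum_ite_eq, Finset.mem_univ, if_true,
    Finset.sum_const, Finset.card_univ, Fintype.card_fin, nsmul_eq_mul]
  field_simp
  ring

theorem abelianWave_kMatrix (n k M : ℕ) : abelianWave n (kMatrix k M) =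
    abelianWave n (fun _ _ : Fin k => 1) ^ M * colouredWave n k := by
  have h1 : ∀ a : Fin k, kMatrix k M a a = M + 2 := fun a => if_pos rfl
  have h2 : ∀ a : Fin k, ∀ b ∈ Finset.Ioi a, ∀ i j : Fin n,
      (MvPolynomial.X (i, a) - MvPolynomial.X (j, b) : MvPolynomial (Fin n × Fin k) ℂ) ^
        kMatrix k M a b = (MvPolynomial.X (i, a) - MvPolynomial.X (j, b)) ^ M := by
    intro a b hb i j
    rw [show kMatrix k M a b = M from if_neg (Finset.mem_Ioi.1 hb).ne]
  simp only [abelianWave, colouredWave, pow_one, mul_pow, ← Finset.prod_pow, h1, pow_add,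
    Finset.prod_mul_distrib]
  rw [mul_assoc]
  congr 1
  exact Finset.prod_congr rfl fun a _ => Finset.prod_congr rfl fun b hb =>
    Finset.prod_congr rfl fun i _ => Finset.prod_congr rfl fun j _ => h2 a b hb i j

end QHE

theorem mainTheorem1 (k : ℕ) (hk : 2 ≤ k) :
    -- the filling fraction of the generalized (331) theory
    (∀ M : ℕ, IsUnit ((QHE.kMatrix k M).map (Nat.cast : ℕ → ℚ)).det ∧
      QHE.filling (QHE.kMatrix k M) = (k : ℚ) / (k * M + 2)) ∧
    -- its wave function is the `M`-th power of the full Jastrow factor times the `M = 0` factor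
    (∀ n M : ℕ, QHE.abelianWave n (QHE.kMatrix k M) =
      QHE.abelianWave n (fun _ _ : Fin k => 1) ^ M * QHE.colouredWave n k) ∧
    -- the symmetrized `M = 0` factor is a non-zero multiple of the Read–Rezayi wave function
    (∀ n : ℕ, QHE.symWave n k ≠ 0 ∧
      ∃ c : ℂ, c ≠ 0 ∧ QHE.symWave n k = c • QHE.readRezayi n k) ∧
    -- and of the correlator of the parafermion theory
    (∀ n : ℕ, ∃ c : ℂ, c ≠ 0 ∧ ∀ z : Fin (n * k) → ℂ, Function.Injective z →
      QHE.IsParafermionCorr k z (c * MvPolynomial.eval z (QHE.symWave n k))) ∧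
    -- factorization of a `k`-cluster, and absence of an additional linear sub-leading term
    (∀ n : ℕ, ∃ c : ℂ, c ≠ 0 ∧
      (∀ (w : ℂ) (y : Fin (n * k) → ℂ),
        MvPolynomial.eval (QHE.joinCluster (fun _ => w) y) (QHE.symWave (n + 1) k) =
          c * (∏ i, (w - y i) ^ 2) * MvPolynomial.eval y (QHE.symWave n k)) ∧
      (∀ (z : ℂ) (y : Fin (n * k) → ℂ), (∀ i, z ≠ y i) →
        (fun u : ℂ =>
          MvPolynomial.eval (QHE.joinCluster (fun a : Fin k => if a.val + 1 = k then z else u) y)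
              (QHE.symWave (n + 1) k) -
            c * ((1 + 2 * ((k : ℂ) - 1) / k * (u - z) * ∑ i, 1 / (z - y i)) *
              ∏ i, (z - y i) ^ 2) * MvPolynomial.eval y (QHE.symWave n k))
          =O[𝓝 z] (fun u : ℂ => (u - z) ^ 2))) := by
  have hk1 : 1 ≤ k := by omega
  refine ⟨fun M => ⟨QHE.isUnit_det_kMatrix k M, QHE.filling_kMatrix k M⟩,
    fun n M => QHE.abelianWave_kMatrix n k M,
    fun n => ⟨QHE.symWave_ne_zero n k, QHE.exists_symWave_eq_smul_readRezayi n hk1⟩,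
    fun n => QHE.exists_isParafermionCorr n k, fun n => ?_⟩
  obtain ⟨c, hc, h⟩ := QHE.exists_eval_symWave_cluster n k
  refine ⟨c, hc, h, fun z y hz => ?_⟩
  have hO := QHE.isBigO_joinCluster (p := QHE.symWave (n + 1) k) hk1
    (QHE.isSymmetric_symmetrize _) z
    (c * MvPolynomial.eval y (QHE.symWave n k)) y hz fun w => (h w y).trans (by ring)
  refine hO.congr_left fun u => ?_
  ring
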